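/- Let $Q$ be a connected, paracompact, Hausdorff $C^{r+1}$ manifold (without boundary) of finite dimension $d$, $r\ge 2$, and let $T\subseteq\mathbb{R}$ be a nonempty open interval. For $t\in T$ let $a_t$ be a Riemannian metric, $b_t$ a 1-form and $V(t,\cdot)$ a real function on $Q$, all of class $C^r$ jointly in $(t,q)\in T\times Q$. Consider the Lagrangian $$L(t,q,v)=\tfrac12 a_t(v,v)+b_t(v)-V(t,q),$$ and the spacetime $M=T\times Q\times\mathbb{R}$ with coordinates $(t,q,y)$ and Lorentzian metric $$g=a_t-dt\otimes(dy-b_t)-(dy-b_t)\otimes dt-2V\,dt^2 .$$ The Euler–Lagrange flow is called complete if every $C^2$ solution $q:J\to Q$ of the Euler–Lagrange equation of $L$ on a nonempty open interval $J\subseteq T$ extends to a solution on all of $\mathbb{R}$ (in particular, this requires $T=\mathbb{R}$). A (semi-)Riemannian manifold is called geodesically complete (resp. null, causally geodesically complete) if every affinely parametrized geodesic (resp. every geodesic with nonzero velocity $\gamma'$ satisfying $g(\gamma',\gamma')=0$, resp. $g(\gamma',\gamma')\le 0$) on a nonempty open interval extends to a geodesic on all of $\mathbb{R}$. Then: 1.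 The Euler–Lagrange flow is complete if and only if $(M,g)$ is null geodesically complete, and in this case $(M,g)$ is causally geodesically complete. 2. The Euler–Lagrange flow is complete and the Riemannian manifolds $(Q,a_t)$ are geodesically complete for all $t\in T$ if and only if $(M,g)$ is geodesically complete. -/

import Mathlib

open scoped Manifold ContDiff Topology
open Set

noncomputable section

/-! ### Geodesics of a (pseudo-)Riemannian metric -/

section Geodesics

variable {E : Type*} [NormedAddCommGroup E] [NormedSpace ℝ E]
  {H : Type*} [TopologicalSpace H] (I : ModelWithCorners ℝ E H)
  {M : Type*} [TopologicalSpace M] [ChartedSpace H M]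

/-- A field of bilinear forms on the tangent spaces of `M`, i.e. a covariant tensor field of
order two. -/
abbrev BilinField : Type _ :=
  (x : M) → LinearMap.BilinForm ℝ (TangentSpace I x)

variable {I}

/-- The components of `g` in the chart of `M` around `x₀`, at the point of `M` with coordinates
`z`: the vectors `u v` of the model space are pushed forward by the inverse of the chart. -/
def chartComp (g : BilinField I (M := M)) (x₀ : M) (z u v : E) : ℝ :=
  g ((extChartAt I x₀).symm z)
    (mfderiv 𝓘(ℝ, E) I (extChartAt I x₀).symm z u)
    (mfderiv 𝓘(ℝ, E) I (extChartAt I x₀).symm z v)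

/-- The Christoffel symbols of the first kind of `g`, in the chart around `x₀`:
`Γ(u, v; w) = (∂_u g(v, w) + ∂_v g(u, w) - ∂_w g(u, v)) / 2` for constant vectors `u v w`. -/
def christoffelFirst (g : BilinField I (M := M)) (x₀ : M) (z u v w : E) : ℝ :=
  (fderiv ℝ (fun x => chartComp g x₀ x v w) z u
    + fderiv ℝ (fun x => chartComp g x₀ x u w) z v
    - fderiv ℝ (fun x => chartComp g x₀ x u v) z w) / 2

/-- `γ` is an (affinely parametrized) geodesic of the metric `g` on the open set `J` of
parameters: it is `C^2` and satisfies `∇_{γ'} γ' = 0`, which is written, at each parameter `s₀`,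
in the chart around `γ s₀` and with the free index lowered by the (nondegenerate) metric:
`g(c'', w) + Γ(c', c'; w) = 0` for all `w`, where `c` is the curve in coordinates. -/
def IsGeodesicOn (g : BilinField I (M := M)) (γ : ℝ → M) (J : Set ℝ) : Prop :=
  ContMDiffOn 𝓘(ℝ, ℝ) I 2 γ J ∧
  ∀ s₀ ∈ J, ∀ w : E,
    let c : ℝ → E := fun s => extChartAt I (γ s₀) (γ s)
    chartComp g (γ s₀) (c s₀) (deriv (deriv c) s₀) w
      + christoffelFirst g (γ s₀) (c s₀) (deriv c s₀) (deriv c s₀) w = 0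

variable (I) in
/-- The velocity of a curve in `M`. -/
def velocity (γ : ℝ → M) (s : ℝ) : TangentSpace I (γ s) :=
  mfderiv 𝓘(ℝ, ℝ) I γ s (1 : ℝ)

/-- The curve `γ` is causal on `J`: its velocity is a nonzero vector that is timelike or
lightlike. -/
def IsCausalOn (g : BilinField I (M := M)) (γ : ℝ → M) (J : Set ℝ) : Prop :=
  ∀ s ∈ J, velocity I γ s ≠ 0 ∧ g (γ s) (velocity I γ s) (velocity I γ s) ≤ 0

/-- The curve `γ` is lightlike (null) on `J`. -/
def IsNullOn (g : BilinField I (M := M)) (γ : ℝ → M) (J : Set ℝ) : Prop :=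
  ∀ s ∈ J, velocity I γ s ≠ 0 ∧ g (γ s) (velocity I γ s) (velocity I γ s) = 0

/-- Every geodesic on an open interval extends to a geodesic on the whole real line. -/
def GeodesicallyComplete (g : BilinField I (M := M)) : Prop :=
  ∀ (J : Set ℝ) (γ : ℝ → M), IsOpen J → J.OrdConnected → J.Nonempty →
    IsGeodesicOn g γ J →
    ∃ γ' : ℝ → M, IsGeodesicOn g γ' univ ∧ EqOn γ' γ J

/-- Every causal geodesic on an open interval extends to a geodesic on the whole real line. -/
def CausallyGeodesicallyComplete (g : BilinField I (M := M)) : Prop :=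
  ∀ (J : Set ℝ) (γ : ℝ → M), IsOpen J → J.OrdConnected → J.Nonempty →
    IsGeodesicOn g γ J → IsCausalOn g γ J →
    ∃ γ' : ℝ → M, IsGeodesicOn g γ' univ ∧ EqOn γ' γ J

/-- Every lightlike geodesic on an open interval extends to a geodesic on the whole real line. -/
def NullGeodesicallyComplete (g : BilinField I (M := M)) : Prop :=
  ∀ (J : Set ℝ) (γ : ℝ → M), IsOpen J → J.OrdConnected → J.Nonempty →
    IsGeodesicOn g γ J → IsNullOn g γ J →
    ∃ γ' : ℝ → M, IsGeodesicOn g γ' univ ∧ EqOn γ' γ J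

end Geodesics

/-! ### Time dependent mechanical systems and their Eisenhart spacetimes -/

section Mechanics

variable {d : ℕ} {Q : Type*} [TopologicalSpace Q] [ChartedSpace (EuclideanSpace ℝ (Fin d)) Q]
  {r : WithTop ℕ∞}

variable (d Q r) in
/-- The data of the Lagrangian `a_t(v, v) / 2 + b_t(v) - V(t, q)` on the `d`-dimensional
manifold `Q`: an open time interval `T` and, for `t ∈ T`, a Riemannian metric `a t`, a one-form
`b t` and a function `V t` on `Q`, all of class `C^r` jointly in `(t, q)`. The values of the
fields at times outside `T` are irrelevant. -/
structure MechanicalSystem where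
  T : TopologicalSpace.Opens ℝ
  T_nonempty : (T : Set ℝ).Nonempty
  T_ordConnected : (T : Set ℝ).OrdConnected
  a : ℝ → BilinField (𝓡 d) (M := Q)
  b : ℝ → (q : Q) → TangentSpace (𝓡 d) q →L[ℝ] ℝ
  V : ℝ → Q → ℝ
  a_symm : ∀ t ∈ T, ∀ (q : Q) (u v : TangentSpace (𝓡 d) q), a t q u v = a t q v u
  a_pos : ∀ t ∈ T, ∀ (q : Q) (v : TangentSpace (𝓡 d) q), v ≠ 0 → 0 < a t q v v
  /-- In the charts of `Q`, the components of `a` are of class `C^r`. -/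
  a_smooth : ∀ (q₀ : Q) (u v : EuclideanSpace ℝ (Fin d)),
    ContDiffOn ℝ r (fun p : ℝ × EuclideanSpace ℝ (Fin d) => chartComp (a p.1) q₀ p.2 u v)
      ((T : Set ℝ) ×ˢ (extChartAt (𝓡 d) q₀).target)
  /-- In the charts of `Q`, the components of `b` are of class `C^r`. -/
  b_smooth : ∀ (q₀ : Q) (v : EuclideanSpace ℝ (Fin d)),
    ContDiffOn ℝ r (fun p : ℝ × EuclideanSpace ℝ (Fin d) =>
        b p.1 ((extChartAt (𝓡 d) q₀).symm p.2)
          (mfderiv 𝓘(ℝ, EuclideanSpace ℝ (Fin d)) (𝓡 d) (extChartAt (𝓡 d) q₀).symm p.2 v))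
      ((T : Set ℝ) ×ˢ (extChartAt (𝓡 d) q₀).target)
  /-- In the charts of `Q`, the function `V` is of class `C^r`. -/
  V_smooth : ∀ q₀ : Q,
    ContDiffOn ℝ r (fun p : ℝ × EuclideanSpace ℝ (Fin d) =>
        V p.1 ((extChartAt (𝓡 d) q₀).symm p.2))
      ((T : Set ℝ) ×ˢ (extChartAt (𝓡 d) q₀).target)

namespace MechanicalSystem

variable (S : MechanicalSystem d Q r)

/-- The Lagrangian `L(t, q, v) = a_t(v, v) / 2 + b_t(v) - V(t, q)`. -/
def lagrangian (t : ℝ) (q : Q) (v : TangentSpace (𝓡 d) q) : ℝ :=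
  S.a t q v v / 2 + S.b t q v - S.V t q

/-- The Lagrangian in the chart of `Q` around `q₀`, as a function of time, coordinates and
coordinate velocity. -/
def chartLagrangian (q₀ : Q) (t : ℝ) (x v : EuclideanSpace ℝ (Fin d)) : ℝ :=
  S.lagrangian t ((extChartAt (𝓡 d) q₀).symm x)
    (mfderiv 𝓘(ℝ, EuclideanSpace ℝ (Fin d)) (𝓡 d) (extChartAt (𝓡 d) q₀).symm x v)

/-- `q` is a solution, on the open set `J` of times, of the Euler-Lagrange equation
`d/dt (∂L/∂v) = ∂L/∂q`, which is written at each time `t₀` in the chart around `q t₀`. -/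
def IsELSolutionOn (q : ℝ → Q) (J : Set ℝ) : Prop :=
  J ⊆ (S.T : Set ℝ) ∧
  ContMDiffOn 𝓘(ℝ, ℝ) (𝓡 d) 2 q J ∧
  ∀ t₀ ∈ J, ∀ w : EuclideanSpace ℝ (Fin d),
    let c : ℝ → EuclideanSpace ℝ (Fin d) := fun t => extChartAt (𝓡 d) (q t₀) (q t)
    deriv (fun t => fderiv ℝ (fun v => S.chartLagrangian (q t₀) t (c t) v) (deriv c t) w) t₀
      = fderiv ℝ (fun x => S.chartLagrangian (q t₀) t₀ x (deriv c t₀)) (c t₀) w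

/-- The Euler-Lagrange flow is complete: every local solution of the Euler-Lagrange equation
extends to a solution that is defined at all real times. -/
def ELFlowComplete : Prop :=
  ∀ (J : Set ℝ) (q : ℝ → Q), IsOpen J → J.OrdConnected → J.Nonempty →
    S.IsELSolutionOn q J →
    ∃ q' : ℝ → Q, S.IsELSolutionOn q' univ ∧ EqOn q' q J

/-- The manifold `M = T × Q × ℝ`, with coordinates `(t, q, y)`. -/
abbrev Spacetime : Type _ := S.T × Q × ℝ

variable (d) in
/-- The model with corners (without boundary) of the spacetime `T × Q × ℝ`. -/
abbrev spacetimeModel : ModelWithCorners ℝ (ℝ × EuclideanSpace ℝ (Fin d) × ℝ)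
    (ModelProd ℝ (ModelProd (EuclideanSpace ℝ (Fin d)) ℝ)) :=
  𝓘(ℝ, ℝ).prod ((𝓡 d).prod 𝓘(ℝ, ℝ))

/-- The one-form `dt` on the spacetime. -/
def dt (x : S.Spacetime) : TangentSpace (spacetimeModel d) x →L[ℝ] ℝ :=
  mfderiv (spacetimeModel d) 𝓘(ℝ, ℝ) (fun p : S.Spacetime => (p.1 : ℝ)) x

/-- The one-form `dy` on the spacetime. -/
def dy (x : S.Spacetime) : TangentSpace (spacetimeModel d) x →L[ℝ] ℝ :=
  mfderiv (spacetimeModel d) 𝓘(ℝ, ℝ) (fun p : S.Spacetime => p.2.2) x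

/-- The differential of the projection of the spacetime onto `Q`. -/
def dq (x : S.Spacetime) : TangentSpace (spacetimeModel d) x →L[ℝ] TangentSpace (𝓡 d) x.2.1 :=
  mfderiv (spacetimeModel d) (𝓡 d) (fun p : S.Spacetime => p.2.1) x

/-- The one-form `dy - b_t` on the spacetime. -/
def dyb (x : S.Spacetime) : TangentSpace (spacetimeModel d) x →L[ℝ] ℝ :=
  S.dy x - (S.b x.1 x.2.1).comp (S.dq x)

/-- The Eisenhart (Brinkmann) metric
`g = a_t - dt ⊗ (dy - b_t) - (dy - b_t) ⊗ dt - 2 V dt ⊗ dt`. -/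
def eisenhartMetric : BilinField (spacetimeModel d) (M := S.Spacetime) := fun x =>
  LinearMap.mk₂ ℝ
    (fun u v => S.a x.1 x.2.1 (S.dq x u) (S.dq x v)
      - S.dt x u * S.dyb x v - S.dyb x u * S.dt x v
      - 2 * S.V x.1 x.2.1 * (S.dt x u * S.dt x v))
    (fun u u' v => by simp only [map_add, LinearMap.add_apply]; ring)
    (fun c u v => by simp only [map_smul, LinearMap.smul_apply, smul_eq_mul]; ring)
    (fun u v v' => by simp only [map_add]; ring)
    (fun c u v => by simp only [map_smul, smul_eq_mul]; ring)

end MechanicalSystem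

end Mechanics

end

/-! Nothing in the Eisenhart metric depends on `y`, and `dy` is paired only with `dt`. The `∂_y`
component of the geodesic equation therefore says `t'' = 0`, so `t = k s + c`
(`exists_time_eq_affine`). The `Q` components then become an equation for `q` alone, the reduced
equation: Euler-Lagrange for `a_t(v, v) / 2 + k b_t(v) - k² V_t` with `t = k s + c`. The `∂_t`
component expresses `y''` through `q`, so `y` is found by two integrations and is determined by its
value and slope at one point. This is `isGeodesicOn_eisenhartMetric_iff`. Hence solutions of the
reduced equation lift to geodesics (`exists_geodesic_lift`), and a geodesic extends once its
projection to `Q` does (`exists_geodesic_extension`).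

For `k = 1`, `c = 0` the reduced equation is the Euler-Lagrange equation, and an affine change of
parameter brings every `k ≠ 0` to this case, because the equation is homogeneous of degree two. For
`k = 0` it is the geodesic equation of `a_c`. Full completeness thus amounts to completeness of the
flow together with completeness of all the `a_t`.

The number `g(γ', γ')` is constant along a geodesic and contains the term `-2 k y'`. For `k = 1` a
suitable initial slope of `y` makes the lift null, so null geodesics already see every
Euler-Lagrange solution. For `k = 0` the number is `a_c(q', q')`, so a causal geodesic has constant
`q`, which extends trivially; completeness of the `a_t` is not needed there. No existence or
uniqueness theorem for nonlinear equations enters. -/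

noncomputable section

set_option maxSynthPendingDepth 3

/-! ### Calculus of a metric, a one-form and a function that depend on time -/

section FieldCalculus

variable {E : Type*} [NormedAddCommGroup E] [NormedSpace ℝ E]
  {A : ℝ × E → E →L[ℝ] E →L[ℝ] ℝ} {B : ℝ × E → E →L[ℝ] ℝ} {V : ℝ × E → ℝ}

theorem HasFDerivAt.apply_const {F : Type*} [NormedAddCommGroup F] [NormedSpace ℝ F]
    {B : F → E →L[ℝ] ℝ} {B' : F →L[ℝ] E →L[ℝ] ℝ} {x : F}
    (hB : HasFDerivAt B B' x) (u : E) : HasFDerivAt (fun x => B x u) (B'.flip u) x := by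
  simpa using hB.clm_apply (hasFDerivAt_const u x)

theorem HasFDerivAt.apply_const₂ {F : Type*} [NormedAddCommGroup F] [NormedSpace ℝ F]
    {A : F → E →L[ℝ] E →L[ℝ] ℝ} {A' : F →L[ℝ] E →L[ℝ] E →L[ℝ] ℝ}
    {x : F} (hA : HasFDerivAt A A' x) (u v : E) :
    HasFDerivAt (fun x => A x u v) ((A'.flip u).flip v) x := by
  have h : HasFDerivAt (fun x => A x u) (A'.flip u) x := by
    simpa using hA.clm_apply (hasFDerivAt_const u x)
  exact h.apply_const v

theorem hasDerivAt_metric_along {τ : ℝ → ℝ} {x u v : ℝ → E} {s τ' : ℝ} {x' u' v' : E}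
    (hA : DifferentiableAt ℝ A (τ s, x s)) (hτ : HasDerivAt τ τ' s)
    (hx : HasDerivAt x x' s) (hu : HasDerivAt u u' s) (hv : HasDerivAt v v' s) :
    HasDerivAt (fun s => A (τ s, x s) (u s) (v s))
      (fderiv ℝ A (τ s, x s) (τ', x') (u s) (v s)
        + A (τ s, x s) u' (v s) + A (τ s, x s) (u s) v') s := by
  have h := hA.hasFDerivAt.comp_hasDerivAt (f := fun s => (τ s, x s)) s (hτ.prodMk hx)
  have h2 : HasDerivAt (fun s => A (τ s, x s) (u s))
    (fderiv ℝ A (τ s, x s) (τ', x') (u s) + A (τ s, x s) u') s := h.clm_apply hu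
  exact h2.clm_apply hv

theorem hasDerivAt_form_along {τ : ℝ → ℝ} {x u : ℝ → E} {s τ' : ℝ} {x' u' : E}
    (hB : DifferentiableAt ℝ B (τ s, x s)) (hτ : HasDerivAt τ τ' s)
    (hx : HasDerivAt x x' s) (hu : HasDerivAt u u' s) :
    HasDerivAt (fun s => B (τ s, x s) (u s))
      (fderiv ℝ B (τ s, x s) (τ', x') (u s) + B (τ s, x s) u') s :=
  (hB.hasFDerivAt.comp_hasDerivAt (f := fun s => (τ s, x s)) s (hτ.prodMk hx)).clm_apply hu

theorem hasDerivAt_potential_along {τ : ℝ → ℝ} {x : ℝ → E} {s τ' : ℝ} {x' : E}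
    (hV : DifferentiableAt ℝ V (τ s, x s)) (hτ : HasDerivAt τ τ' s) (hx : HasDerivAt x x' s) :
    HasDerivAt (fun s => V (τ s, x s)) (fderiv ℝ V (τ s, x s) (τ', x')) s :=
  hV.hasFDerivAt.comp_hasDerivAt (f := fun s => (τ s, x s)) s (hτ.prodMk hx)

theorem fderiv_lagrangian_velocity (A : E →L[ℝ] E →L[ℝ] ℝ) (B : E →L[ℝ] ℝ) (c : ℝ) (v w : E) :
    fderiv ℝ (fun v => A v v / 2 + B v - c) v w = (A v w + A w v) / 2 + B w := by
  have hA : HasFDerivAt (fun v => A v v) (A v + A.flip v) v := by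
    simpa using A.hasFDerivAt.clm_apply (hasFDerivAt_id v)
  have h := ((hA.const_mul 2⁻¹).fun_add B.hasFDerivAt).sub_const c
  simp only [← div_eq_inv_mul] at h
  refine (DFunLike.congr_fun h.fderiv w).trans ?_
  simp
  ring

theorem hasFDerivAt_metric_position {t : ℝ} {x : E} (hA : DifferentiableAt ℝ A (t, x)) (v w : E) :
    HasFDerivAt (fun x => A (t, x) v w) ((((fderiv ℝ A (t, x)).comp
      (ContinuousLinearMap.inr ℝ ℝ E)).flip v).flip w) x :=
  (hA.hasFDerivAt.comp x (hasFDerivAt_prodMk_right t x)).apply_const₂ v w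

theorem fderiv_metric_position {t : ℝ} {x : E} (hA : DifferentiableAt ℝ A (t, x)) (v w u : E) :
    fderiv ℝ (fun x => A (t, x) v w) x u = fderiv ℝ A (t, x) (0, u) v w := by
  rw [(hasFDerivAt_metric_position hA v w).fderiv]
  simp

theorem fderiv_lagrangian_position {t : ℝ} {x : E} (hA : DifferentiableAt ℝ A (t, x))
    (hB : DifferentiableAt ℝ B (t, x)) (hV : DifferentiableAt ℝ V (t, x)) (v w : E) :
    fderiv ℝ (fun x => A (t, x) v v / 2 + B (t, x) v - V (t, x)) x w
      = fderiv ℝ A (t, x) (0, w) v v / 2 + fderiv ℝ B (t, x) (0, w) v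
        - fderiv ℝ V (t, x) (0, w) := by
  have h1 := hasFDerivAt_metric_position hA v v
  have h2 := (hB.hasFDerivAt.comp x (hasFDerivAt_prodMk_right t x)).apply_const v
  have h3 := hV.hasFDerivAt.comp x (hasFDerivAt_prodMk_right t x)
  have h := ((h1.const_mul 2⁻¹).fun_add h2).fun_sub h3
  simp only [← div_eq_inv_mul] at h
  refine (DFunLike.congr_fun h.fderiv w).trans ?_
  simp
  ring

theorem hasDerivAt_lagrangian_time {t : ℝ} {x : E} (hA : DifferentiableAt ℝ A (t, x))
    (hB : DifferentiableAt ℝ B (t, x)) (hV : DifferentiableAt ℝ V (t, x)) (k : ℝ) (v : E) :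
    HasDerivAt (fun t => A (t, x) v v / 2 + k * B (t, x) v - k ^ 2 * V (t, x))
      (fderiv ℝ A (t, x) (1, 0) v v / 2 + k * fderiv ℝ B (t, x) (1, 0) v
        - k ^ 2 * fderiv ℝ V (t, x) (1, 0)) t := by
  have hx := hasDerivAt_const t x
  have hv := hasDerivAt_const t v
  have h1 := hasDerivAt_metric_along hA (hasDerivAt_id t) hx hv hv
  have h2 := hasDerivAt_form_along hB (hasDerivAt_id t) hx hv
  have h3 := hasDerivAt_potential_along hV (hasDerivAt_id t) hx
  have h := ((h1.div_const 2).fun_add (h2.const_mul k)).fun_sub (h3.const_mul (k ^ 2))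
  simp only [map_zero, add_zero, id, zero_apply] at h
  exact h

/-- The `dt dy` coefficients are constant and the last coordinate never enters, so only derivatives
of the three fields in the direction `(u.1, u.2.1)` survive. -/
theorem fderiv_brinkmann {z : ℝ × E × ℝ} (hA : DifferentiableAt ℝ A (z.1, z.2.1))
    (hB : DifferentiableAt ℝ B (z.1, z.2.1)) (hV : DifferentiableAt ℝ V (z.1, z.2.1))
    (u v w : ℝ × E × ℝ) :
    fderiv ℝ (fun z : ℝ × E × ℝ => A (z.1, z.2.1) v.2.1 w.2.1
        - v.1 * (w.2.2 - B (z.1, z.2.1) w.2.1) - (v.2.2 - B (z.1, z.2.1) v.2.1) * w.1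
        - 2 * V (z.1, z.2.1) * (v.1 * w.1)) z u
      = fderiv ℝ A (z.1, z.2.1) (u.1, u.2.1) v.2.1 w.2.1
        + v.1 * fderiv ℝ B (z.1, z.2.1) (u.1, u.2.1) w.2.1
        + w.1 * fderiv ℝ B (z.1, z.2.1) (u.1, u.2.1) v.2.1
        - 2 * fderiv ℝ V (z.1, z.2.1) (u.1, u.2.1) * (v.1 * w.1) := by
  have hp : HasFDerivAt (fun z : ℝ × E × ℝ => (z.1, z.2.1)) ((ContinuousLinearMap.fst ℝ ℝ (E × ℝ)).prod
      ((ContinuousLinearMap.fst ℝ E ℝ).comp (ContinuousLinearMap.snd ℝ ℝ (E × ℝ)))) z :=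
    ((ContinuousLinearMap.fst ℝ ℝ (E × ℝ)).prod
      ((ContinuousLinearMap.fst ℝ E ℝ).comp (ContinuousLinearMap.snd ℝ ℝ (E × ℝ)))).hasFDerivAt
  have h1 := (hA.hasFDerivAt.comp z hp).apply_const₂ v.2.1 w.2.1
  have h2 := (hB.hasFDerivAt.comp z hp).apply_const w.2.1
  have h3 := (hB.hasFDerivAt.comp z hp).apply_const v.2.1
  have h4 := hV.hasFDerivAt.comp z hp
  have h := ((h1.fun_sub ((h2.const_sub w.2.2).const_mul v.1)).fun_sub
    ((h3.const_sub v.2.2).mul_const w.1)).fun_sub ((h4.const_mul 2).mul_const (v.1 * w.1))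
  refine (DFunLike.congr_fun h.fderiv u).trans ?_
  simp
  ring

theorem contDiffAt_momentum {τ : ℝ → ℝ} {x v : ℝ → E} {s : ℝ} (hB : ContDiffAt ℝ 1 B (τ s, x s))
    (hV : ContDiffAt ℝ 1 V (τ s, x s)) (hτ : ContDiffAt ℝ 1 τ s) (hx : ContDiffAt ℝ 1 x s)
    (hv : ContDiffAt ℝ 1 v s) (k : ℝ) :
    ContDiffAt ℝ 1 (fun s => B (τ s, x s) (v s) - 2 * k * V (τ s, x s)) s := by
  have h := hτ.prodMk hx
  exact ((hB.comp s h).clm_apply hv).sub (contDiffAt_const.mul (hV.comp s h))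

theorem continuousAt_lagrangian_time {τ : ℝ → ℝ} {x v : ℝ → E} {s : ℝ}
    (hA : ContDiffAt ℝ 1 A (τ s, x s)) (hB : ContDiffAt ℝ 1 B (τ s, x s))
    (hV : ContDiffAt ℝ 1 V (τ s, x s)) (hτ : ContinuousAt τ s) (hx : ContinuousAt x s)
    (hv : ContinuousAt v s) (k : ℝ) :
    ContinuousAt (fun s => fderiv ℝ A (τ s, x s) (1, 0) (v s) (v s) / 2
        + k * fderiv ℝ B (τ s, x s) (1, 0) (v s) - k ^ 2 * fderiv ℝ V (τ s, x s) (1, 0)) s := by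
  have h := hτ.prodMk hx
  have cA : ContinuousAt (fun s => fderiv ℝ A (τ s, x s)) s :=
    ContinuousAt.comp (f := fun s => (τ s, x s)) (hA.continuousAt_fderiv one_ne_zero) h
  have cB : ContinuousAt (fun s => fderiv ℝ B (τ s, x s)) s :=
    ContinuousAt.comp (f := fun s => (τ s, x s)) (hB.continuousAt_fderiv one_ne_zero) h
  have cV : ContinuousAt (fun s => fderiv ℝ V (τ s, x s)) s :=
    ContinuousAt.comp (f := fun s => (τ s, x s)) (hV.continuousAt_fderiv one_ne_zero) h
  fun_prop

end FieldCalculus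

namespace MechanicalSystem

variable {d : ℕ} {Q : Type*} [TopologicalSpace Q] [ChartedSpace (EuclideanSpace ℝ (Fin d)) Q]
  {r : WithTop ℕ∞}

local notation "𝔼" => EuclideanSpace ℝ (Fin d)

/-! ### The fields of a mechanical system in a chart -/

section ChartFields

variable (S : MechanicalSystem d Q r)

/-- The differential of the inverse of the chart of `Q` around `q₀`. -/
def chartPush (q₀ : Q) (x : 𝔼) : 𝔼 →ₗ[ℝ] TangentSpace (𝓡 d) ((extChartAt (𝓡 d) q₀).symm x) :=
  (mfderiv 𝓘(ℝ, 𝔼) (𝓡 d) (extChartAt (𝓡 d) q₀).symm x).toLinearMap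

/-- The metrics `a_t` in the chart of `Q` around `q₀`. -/
def chartMetric (q₀ : Q) (p : ℝ × 𝔼) : 𝔼 →L[ℝ] 𝔼 →L[ℝ] ℝ :=
  LinearMap.toContinuousBilinearMap
    ((S.a p.1 ((extChartAt (𝓡 d) q₀).symm p.2)).compl₁₂ (chartPush q₀ p.2) (chartPush q₀ p.2))

/-- The one-forms `b_t` in the chart of `Q` around `q₀`. -/
def chartForm (q₀ : Q) (p : ℝ × 𝔼) : 𝔼 →L[ℝ] ℝ :=
  (S.b p.1 ((extChartAt (𝓡 d) q₀).symm p.2)).comp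
    (mfderiv 𝓘(ℝ, 𝔼) (𝓡 d) (extChartAt (𝓡 d) q₀).symm p.2)

/-- The functions `V_t` in the chart of `Q` around `q₀`. -/
def chartPotential (q₀ : Q) (p : ℝ × 𝔼) : ℝ :=
  S.V p.1 ((extChartAt (𝓡 d) q₀).symm p.2)

/-- The times and coordinates in the domain of the chart of `Q` around `q₀`. -/
def chartDomain (q₀ : Q) : Set (ℝ × 𝔼) := (S.T : Set ℝ) ×ˢ (extChartAt (𝓡 d) q₀).target

theorem chartMetric_apply (q₀ : Q) (p : ℝ × 𝔼) (u v : 𝔼) :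
    S.chartMetric q₀ p u v = chartComp (S.a p.1) q₀ p.2 u v := rfl

theorem isOpen_chartDomain (q₀ : Q) : IsOpen (S.chartDomain q₀) :=
  S.T.isOpen.prod (isOpen_extChartAt_target q₀)

theorem chartMetric_symm {q₀ : Q} {p : ℝ × 𝔼} (hp : p.1 ∈ S.T) (u v : 𝔼) :
    S.chartMetric q₀ p u v = S.chartMetric q₀ p v u :=
  S.a_symm _ hp _ _ _

/-- In finite dimension, regularity of an operator-valued map can be tested on fixed vectors, which
is how the fields of `MechanicalSystem` are assumed to be smooth. -/
theorem contDiffOn_chartMetric (hr : 1 ≤ r) (q₀ : Q) :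
    ContDiffOn ℝ 1 (S.chartMetric q₀) (S.chartDomain q₀) :=
  contDiffOn_clm_apply.2 fun u => contDiffOn_clm_apply.2 fun v => (S.a_smooth q₀ u v).of_le hr

theorem contDiffOn_chartForm (hr : 1 ≤ r) (q₀ : Q) :
    ContDiffOn ℝ 1 (S.chartForm q₀) (S.chartDomain q₀) :=
  contDiffOn_clm_apply.2 fun v => (S.b_smooth q₀ v).of_le hr

theorem contDiffOn_chartPotential (hr : 1 ≤ r) (q₀ : Q) :
    ContDiffOn ℝ 1 (S.chartPotential q₀) (S.chartDomain q₀) :=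
  (S.V_smooth q₀).of_le hr

theorem differentiableAt_chartMetric (hr : 1 ≤ r) {q₀ : Q} {p : ℝ × 𝔼}
    (hp : p ∈ S.chartDomain q₀) : DifferentiableAt ℝ (S.chartMetric q₀) p :=
  ((S.contDiffOn_chartMetric hr q₀).contDiffAt
    ((S.isOpen_chartDomain q₀).mem_nhds hp)).differentiableAt one_ne_zero

theorem differentiableAt_chartForm (hr : 1 ≤ r) {q₀ : Q} {p : ℝ × 𝔼}
    (hp : p ∈ S.chartDomain q₀) : DifferentiableAt ℝ (S.chartForm q₀) p :=
  ((S.contDiffOn_chartForm hr q₀).contDiffAt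
    ((S.isOpen_chartDomain q₀).mem_nhds hp)).differentiableAt one_ne_zero

theorem differentiableAt_chartPotential (hr : 1 ≤ r) {q₀ : Q} {p : ℝ × 𝔼}
    (hp : p ∈ S.chartDomain q₀) : DifferentiableAt ℝ (S.chartPotential q₀) p :=
  ((S.contDiffOn_chartPotential hr q₀).contDiffAt
    ((S.isOpen_chartDomain q₀).mem_nhds hp)).differentiableAt one_ne_zero

end ChartFields

/-! ### The Eisenhart metric in a chart -/

section EisenhartChart

variable (S : MechanicalSystem d Q r)

/-- The chart of the open subset `T` of the line is the inclusion and that of the line is the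
identity. -/
theorem mem_target_spacetime {x₀ : S.Spacetime} {z : ℝ × 𝔼 × ℝ} :
    z ∈ (extChartAt (spacetimeModel d) x₀).target ↔
      z.1 ∈ S.T ∧ z.2.1 ∈ (extChartAt (𝓡 d) x₀.2.1).target := by
  have hT : (extChartAt 𝓘(ℝ, ℝ) x₀.1).target = S.T := by
    simp [TopologicalSpace.Opens.chartAt_eq, chartAt_self_eq, extChartAt, OpenPartialHomeomorph.subtypeRestr_def]
  have hR : (extChartAt 𝓘(ℝ, ℝ) x₀.2.2).target = univ := by simp [chartAt_self_eq]
  rw [extChartAt_prod, PartialEquiv.prod_target, extChartAt_prod, PartialEquiv.prod_target, hT, hR]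
  simp

theorem symm_spacetime_fst {x₀ : S.Spacetime} {z : ℝ × 𝔼 × ℝ}
    (hz : z ∈ (extChartAt (spacetimeModel d) x₀).target) :
    (((extChartAt (spacetimeModel d) x₀).symm z).1 : ℝ) = z.1 :=
  congrArg Prod.fst ((extChartAt (spacetimeModel d) x₀).right_inv hz)

theorem mdifferentiableAt_time (x : S.Spacetime) :
    MDifferentiableAt (spacetimeModel d) 𝓘(ℝ, ℝ) (fun p : S.Spacetime => (p.1 : ℝ)) x :=
  (contMDiff_subtype_val (n := 1) |>.comp contMDiff_fst).contMDiffAt.mdifferentiableAt one_ne_zero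

theorem mdifferentiableAt_position (x : S.Spacetime) :
    MDifferentiableAt (spacetimeModel d) (𝓡 d) (fun p : S.Spacetime => p.2.1) x :=
  (contMDiff_fst (n := 1) |>.comp contMDiff_snd).contMDiffAt.mdifferentiableAt one_ne_zero

theorem mdifferentiableAt_height (x : S.Spacetime) :
    MDifferentiableAt (spacetimeModel d) 𝓘(ℝ, ℝ) (fun p : S.Spacetime => p.2.2) x :=
  (contMDiff_snd (n := 1) |>.comp contMDiff_snd).contMDiffAt.mdifferentiableAt one_ne_zero

variable [IsManifold (𝓡 d) 1 Q]

theorem mdifferentiableAt_symm_spacetime {x₀ : S.Spacetime} {z : ℝ × 𝔼 × ℝ}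
    (hz : z ∈ (extChartAt (spacetimeModel d) x₀).target) :
    MDifferentiableAt 𝓘(ℝ, ℝ × 𝔼 × ℝ) (spacetimeModel d)
      (extChartAt (spacetimeModel d) x₀).symm z :=
  (contMDiffOn_extChartAt_symm (n := 1) x₀).contMDiffAt
    ((isOpen_extChartAt_target x₀).mem_nhds hz) |>.mdifferentiableAt one_ne_zero

theorem mdifferentiableAt_symm {q₀ : Q} {z : 𝔼} (hz : z ∈ (extChartAt (𝓡 d) q₀).target) :
    MDifferentiableAt 𝓘(ℝ, 𝔼) (𝓡 d) (extChartAt (𝓡 d) q₀).symm z :=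
  (contMDiffOn_extChartAt_symm (n := 1) q₀).contMDiffAt
    ((isOpen_extChartAt_target q₀).mem_nhds hz) |>.mdifferentiableAt one_ne_zero

theorem dt_mfderiv_symm {x₀ : S.Spacetime} {z : ℝ × 𝔼 × ℝ}
    (hz : z ∈ (extChartAt (spacetimeModel d) x₀).target) (u : ℝ × 𝔼 × ℝ) :
    S.dt ((extChartAt (spacetimeModel d) x₀).symm z)
      (mfderiv 𝓘(ℝ, ℝ × 𝔼 × ℝ) (spacetimeModel d) (extChartAt (spacetimeModel d) x₀).symm z u)
      = u.1 := by
  have h := mfderiv_comp_apply z (S.mdifferentiableAt_time _)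
    (S.mdifferentiableAt_symm_spacetime hz) u
  have e : (fun p : S.Spacetime => (p.1 : ℝ)) ∘ (extChartAt (spacetimeModel d) x₀).symm
      =ᶠ[𝓝 z] Prod.fst := by
    filter_upwards [(isOpen_extChartAt_target x₀).mem_nhds hz] with w hw
    exact S.symm_spacetime_fst hw
  refine h.symm.trans ?_
  rw [e.mfderiv_eq, mfderiv_eq_fderiv, fderiv_fst]
  rfl

theorem dy_mfderiv_symm {x₀ : S.Spacetime} {z : ℝ × 𝔼 × ℝ}
    (hz : z ∈ (extChartAt (spacetimeModel d) x₀).target) (u : ℝ × 𝔼 × ℝ) :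
    S.dy ((extChartAt (spacetimeModel d) x₀).symm z)
      (mfderiv 𝓘(ℝ, ℝ × 𝔼 × ℝ) (spacetimeModel d) (extChartAt (spacetimeModel d) x₀).symm z u)
      = u.2.2 := by
  have h := mfderiv_comp_apply z (S.mdifferentiableAt_height _)
    (S.mdifferentiableAt_symm_spacetime hz) u
  refine h.symm.trans ?_
  have e : (fun p : S.Spacetime => p.2.2) ∘ (extChartAt (spacetimeModel d) x₀).symm
    = fun z : ℝ × 𝔼 × ℝ => z.2.2 := rfl
  have h1 : HasFDerivAt (fun z : ℝ × 𝔼 × ℝ => z.2.2) ((ContinuousLinearMap.snd ℝ 𝔼 ℝ).comp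
    (ContinuousLinearMap.snd ℝ ℝ (𝔼 × ℝ))) z :=
    ((ContinuousLinearMap.snd ℝ 𝔼 ℝ).comp (ContinuousLinearMap.snd ℝ ℝ (𝔼 × ℝ))).hasFDerivAt
  rw [e, mfderiv_eq_fderiv, h1.fderiv]
  rfl

/-- The projection to `Q` intertwines the inverse charts of the spacetime and of `Q`; the chain rule
is applied to both factorizations. -/
theorem dq_mfderiv_symm {x₀ : S.Spacetime} {z : ℝ × 𝔼 × ℝ}
    (hz : z ∈ (extChartAt (spacetimeModel d) x₀).target) (u : ℝ × 𝔼 × ℝ) :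
    S.dq ((extChartAt (spacetimeModel d) x₀).symm z)
      (mfderiv 𝓘(ℝ, ℝ × 𝔼 × ℝ) (spacetimeModel d) (extChartAt (spacetimeModel d) x₀).symm z u)
      = mfderiv 𝓘(ℝ, 𝔼) (𝓡 d) (extChartAt (𝓡 d) x₀.2.1).symm z.2.1 u.2.1 := by
  have h := mfderiv_comp_apply z (S.mdifferentiableAt_position _)
    (S.mdifferentiableAt_symm_spacetime hz) u
  refine h.symm.trans ?_
  have e : (fun p : S.Spacetime => p.2.1) ∘ (extChartAt (spacetimeModel d) x₀).symm
    = (extChartAt (𝓡 d) x₀.2.1).symm ∘ fun z : ℝ × 𝔼 × ℝ => z.2.1 := rfl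
  have h1 : HasFDerivAt (fun z : ℝ × 𝔼 × ℝ => z.2.1) ((ContinuousLinearMap.fst ℝ 𝔼 ℝ).comp
    (ContinuousLinearMap.snd ℝ ℝ (𝔼 × ℝ))) z :=
    ((ContinuousLinearMap.fst ℝ 𝔼 ℝ).comp (ContinuousLinearMap.snd ℝ ℝ (𝔼 × ℝ))).hasFDerivAt
  have h2 := mfderiv_comp_apply z
    (mdifferentiableAt_symm (q₀ := x₀.2.1) (S.mem_target_spacetime.1 hz).2)
    h1.hasMFDerivAt.mdifferentiableAt u
  rw [e]
  refine h2.trans ?_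
  rw [mfderiv_eq_fderiv, h1.fderiv]
  rfl

/-- The components of the Eisenhart metric in terms of those of `a_t`, `b_t` and `V_t`. -/
theorem chartComp_eisenhartMetric {x₀ : S.Spacetime} {z : ℝ × 𝔼 × ℝ}
    (hz : z ∈ (extChartAt (spacetimeModel d) x₀).target) (u v : ℝ × 𝔼 × ℝ) :
    chartComp S.eisenhartMetric x₀ z u v =
      S.chartMetric x₀.2.1 (z.1, z.2.1) u.2.1 v.2.1
      - u.1 * (v.2.2 - S.chartForm x₀.2.1 (z.1, z.2.1) v.2.1)
      - (u.2.2 - S.chartForm x₀.2.1 (z.1, z.2.1) u.2.1) * v.1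
      - 2 * S.chartPotential x₀.2.1 (z.1, z.2.1) * (u.1 * v.1) := by
  simp only [chartComp, eisenhartMetric, LinearMap.mk₂_apply, dyb, sub_apply,
    ContinuousLinearMap.comp_apply]
  simp only [S.dt_mfderiv_symm hz, S.dy_mfderiv_symm hz, S.dq_mfderiv_symm hz,
    S.symm_spacetime_fst hz]
  rfl

end EisenhartChart

/-! ### Curves in coordinates -/

section Curves

variable (d) in
/-- The curve `q` in the chart of `Q` around `q s₀`. -/
def coordCurve (q : ℝ → Q) (s₀ : ℝ) : ℝ → 𝔼 := fun s => extChartAt (𝓡 d) (q s₀) (q s)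

theorem coordCurve_mem_target (q : ℝ → Q) (s : ℝ) :
    coordCurve d q s s ∈ (extChartAt (𝓡 d) (q s)).target :=
  mem_extChartAt_target (q s)

variable {q : ℝ → Q} {J : Set ℝ} {s₀ : ℝ}

theorem eventually_symm_coordCurve (hJ : IsOpen J) (hq : ContMDiffOn 𝓘(ℝ, ℝ) (𝓡 d) 2 q J)
    (hs : s₀ ∈ J) :
    ∀ᶠ s in 𝓝 s₀, (extChartAt (𝓡 d) (q s₀)).symm (coordCurve d q s₀ s) = q s := by
  have h := (hq.contMDiffAt (hJ.mem_nhds hs)).continuousAt.preimage_mem_nhds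
    (extChartAt_source_mem_nhds (I := 𝓡 d) (q s₀))
  filter_upwards [h] with s h
  exact (extChartAt (𝓡 d) (q s₀)).left_inv h

theorem contDiffAt_coordCurve (hJ : IsOpen J) (hq : ContMDiffOn 𝓘(ℝ, ℝ) (𝓡 d) 2 q J)
    (hs : s₀ ∈ J) : ContDiffAt ℝ 2 (coordCurve d q s₀) s₀ :=
  (contMDiffAt_extChartAt.comp s₀ (hq.contMDiffAt (hJ.mem_nhds hs))).contDiffAt

theorem eventually_hasDerivAt_coordCurve (hJ : IsOpen J)
    (hq : ContMDiffOn 𝓘(ℝ, ℝ) (𝓡 d) 2 q J) (hs : s₀ ∈ J) :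
    ∀ᶠ s in 𝓝 s₀, HasDerivAt (coordCurve d q s₀) (deriv (coordCurve d q s₀) s) s := by
  filter_upwards [(contDiffAt_coordCurve hJ hq hs).eventually (by simp)] with s h
  exact (h.differentiableAt two_ne_zero).hasDerivAt

theorem contDiffAt_deriv_coordCurve (hJ : IsOpen J) (hq : ContMDiffOn 𝓘(ℝ, ℝ) (𝓡 d) 2 q J)
    (hs : s₀ ∈ J) : ContDiffAt ℝ 1 (deriv (coordCurve d q s₀)) s₀ :=
  (contDiffAt_coordCurve hJ hq hs).derivWithin (m := 1) (by norm_num)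

theorem hasDerivAt_deriv_coordCurve (hJ : IsOpen J) (hq : ContMDiffOn 𝓘(ℝ, ℝ) (𝓡 d) 2 q J)
    (hs : s₀ ∈ J) :
    HasDerivAt (deriv (coordCurve d q s₀)) (deriv (deriv (coordCurve d q s₀)) s₀) s₀ :=
  ((contDiffAt_deriv_coordCurve hJ hq hs).differentiableAt one_ne_zero).hasDerivAt

theorem eventually_coordCurve_mem_target (hJ : IsOpen J)
    (hq : ContMDiffOn 𝓘(ℝ, ℝ) (𝓡 d) 2 q J) (hs : s₀ ∈ J) :
    ∀ᶠ s in 𝓝 s₀, coordCurve d q s₀ s ∈ (extChartAt (𝓡 d) (q s₀)).target :=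
  (contDiffAt_coordCurve hJ hq hs).continuousAt.preimage_mem_nhds
    ((isOpen_extChartAt_target (q s₀)).mem_nhds (coordCurve_mem_target q s₀))

/-- The two velocities are tangent at points that are equal only propositionally, so they are
compared through an arbitrary function of point and vector. The same device is used in
`eventually_apply_velocity`. -/
theorem velocity_congr {q q' : ℝ → Q} (h : q =ᶠ[𝓝 s₀] q')
    (f : (p : Q) → TangentSpace (𝓡 d) p → ℝ) :
    f (q s₀) (velocity (𝓡 d) q s₀) = f (q' s₀) (velocity (𝓡 d) q' s₀) := by
  have h1 : (velocity (𝓡 d) q s₀ : 𝔼) = velocity (𝓡 d) q' s₀ := by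
    exact congrArg (fun L : ℝ →L[ℝ] 𝔼 => L 1) h.mfderiv_eq
  exact congrArg₂ (fun (p : Q) (v : 𝔼) => f p v) h.eq_of_nhds h1

variable [IsManifold (𝓡 d) 2 Q]

/-- The velocity in coordinates. -/
theorem eventually_apply_velocity (hJ : IsOpen J) (hq : ContMDiffOn 𝓘(ℝ, ℝ) (𝓡 d) 2 q J)
    (hs : s₀ ∈ J) :
    ∀ᶠ s in 𝓝 s₀, ∀ f : (p : Q) → TangentSpace (𝓡 d) p → ℝ,
      f (q s) (velocity (𝓡 d) q s) = f ((extChartAt (𝓡 d) (q s₀)).symm (coordCurve d q s₀ s))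
        (mfderiv 𝓘(ℝ, 𝔼) (𝓡 d) (extChartAt (𝓡 d) (q s₀)).symm (coordCurve d q s₀ s)
          (deriv (coordCurve d q s₀) s)) := by
  have : IsManifold (𝓡 d) 1 Q := IsManifold.of_le (n := 2) one_le_two
  filter_upwards [(eventually_symm_coordCurve hJ hq hs).eventually_nhds,
    eventually_hasDerivAt_coordCurve hJ hq hs,
    eventually_coordCurve_mem_target hJ hq hs] with s h1 h2 h3 f
  refine (velocity_congr (q' := (extChartAt (𝓡 d) (q s₀)).symm ∘ coordCurve d q s₀)
    (h1.mono fun _ h => h.symm) f).trans ?_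
  have h := mfderiv_comp_apply s (mdifferentiableAt_symm h3)
    h2.hasFDerivAt.hasMFDerivAt.mdifferentiableAt (1 : ℝ)
  have e : (velocity (𝓡 d) ((extChartAt (𝓡 d) (q s₀)).symm ∘ coordCurve d q s₀) s : 𝔼) =
      mfderiv 𝓘(ℝ, 𝔼) (𝓡 d) (extChartAt (𝓡 d) (q s₀)).symm (coordCurve d q s₀ s)
          (deriv (coordCurve d q s₀) s) := by
    refine h.trans ?_
    rw [mfderiv_eq_fderiv]
    rfl
  exact congrArg (fun v : 𝔼 => f ((extChartAt (𝓡 d) (q s₀)).symm (coordCurve d q s₀ s)) v) e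

end Curves

/-! ### The reduced equation -/

section Reduced

variable (S : MechanicalSystem d Q r)

/-- The left-hand side, paired with `w`, of the Euler-Lagrange equation in coordinates of the
Lagrangian `a_t(v, v) / 2 + k b_t(v) - k² V_t` for a curve with `t' = k`, at time and position `p`,
with velocity `v` and acceleration `z`. -/
def chartEL (q₀ : Q) (k : ℝ) (p : ℝ × 𝔼) (v z w : 𝔼) : ℝ :=
  S.chartMetric q₀ p z w + fderiv ℝ (S.chartMetric q₀) p (k, v) v w
    + k * fderiv ℝ (S.chartForm q₀) p (k, v) w
    - (fderiv ℝ (S.chartMetric q₀) p (0, w) v v / 2 + k * fderiv ℝ (S.chartForm q₀) p (0, w) v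
      - k ^ 2 * fderiv ℝ (S.chartPotential q₀) p (0, w))

/-- The equation satisfied by the `Q`-component of a geodesic of the Eisenhart metric along which
`t = k s + c`. -/
structure IsReducedSolutionOn (k c : ℝ) (q : ℝ → Q) (J : Set ℝ) : Prop where
  mem : ∀ s ∈ J, k * s + c ∈ S.T
  contMDiffOn : ContMDiffOn 𝓘(ℝ, ℝ) (𝓡 d) 2 q J
  eq_zero : ∀ s ∈ J, ∀ w, S.chartEL (q s) k (k * s + c, coordCurve d q s s)
    (deriv (coordCurve d q s) s) (deriv (deriv (coordCurve d q s)) s) w = 0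

theorem chartLagrangian_eq (q₀ : Q) (t : ℝ) (x v : 𝔼) :
    S.chartLagrangian q₀ t x v = S.chartMetric q₀ (t, x) v v / 2 + S.chartForm q₀ (t, x) v
      - S.chartPotential q₀ (t, x) := rfl

theorem fderiv_chartLagrangian_velocity (q₀ : Q) {t : ℝ} (ht : t ∈ S.T) (x v w : 𝔼) :
    fderiv ℝ (fun v => S.chartLagrangian q₀ t x v) v w
      = S.chartMetric q₀ (t, x) v w + S.chartForm q₀ (t, x) w := by
  simp only [chartLagrangian_eq]
  rw [fderiv_lagrangian_velocity, S.chartMetric_symm (p := (t, x)) ht w v]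
  ring

theorem fderiv_chartLagrangian_position (hr : 1 ≤ r) (q₀ : Q) {t : ℝ} {x : 𝔼}
    (hp : (t, x) ∈ S.chartDomain q₀) (v w : 𝔼) :
    fderiv ℝ (fun x => S.chartLagrangian q₀ t x v) x w
      = fderiv ℝ (S.chartMetric q₀) (t, x) (0, w) v v / 2
        + fderiv ℝ (S.chartForm q₀) (t, x) (0, w) v
        - fderiv ℝ (S.chartPotential q₀) (t, x) (0, w) := by
  simp only [chartLagrangian_eq]
  exact fderiv_lagrangian_position (S.differentiableAt_chartMetric hr hp)
    (S.differentiableAt_chartForm hr hp) (S.differentiableAt_chartPotential hr hp) v w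

/-- Expanding the time derivative of the momentum `a(q', w) + b(w)` by the chain rule gives exactly
`chartEL` with `k = 1`. -/
theorem isELSolutionOn_iff (hr : 1 ≤ r) {q : ℝ → Q} {J : Set ℝ} (hJ : IsOpen J) :
    S.IsELSolutionOn q J ↔ S.IsReducedSolutionOn 1 0 q J := by
  have key : ∀ (_ : J ⊆ (S.T : Set ℝ)) (_ : ContMDiffOn 𝓘(ℝ, ℝ) (𝓡 d) 2 q J), ∀ t ∈ J, ∀ w : 𝔼,
      deriv (fun t' => fderiv ℝ (fun v => S.chartLagrangian (q t) t' (coordCurve d q t t') v)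
          (deriv (coordCurve d q t) t') w) t
        - fderiv ℝ (fun x => S.chartLagrangian (q t) t x (deriv (coordCurve d q t) t))
          (coordCurve d q t t) w
      = S.chartEL (q t) 1 (1 * t + 0, coordCurve d q t t)
        (deriv (coordCurve d q t) t) (deriv (deriv (coordCurve d q t)) t) w := by
    intro hT hq t ht w
    have hp : (t, coordCurve d q t t) ∈ S.chartDomain (q t) := ⟨hT ht, coordCurve_mem_target q t⟩
    have hx := (eventually_hasDerivAt_coordCurve hJ hq ht).self_of_nhds
    have hA := hasDerivAt_metric_along (τ := fun t => t)
      (S.differentiableAt_chartMetric hr hp) (hasDerivAt_id t) hx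
      (hasDerivAt_deriv_coordCurve hJ hq ht) (hasDerivAt_const t w)
    have hB := hasDerivAt_form_along (τ := fun t => t)
      (S.differentiableAt_chartForm hr hp) (hasDerivAt_id t) hx
      (hasDerivAt_const t w)
    -- The formula for the momentum uses the symmetry of `a`, known only at times in `T`; openness
    -- of `T` makes it valid near `t`, as differentiation requires.
    have e : (fun t' => fderiv ℝ (fun v => S.chartLagrangian (q t) t' (coordCurve d q t t') v)
          (deriv (coordCurve d q t) t') w) =ᶠ[𝓝 t] fun t' =>
        S.chartMetric (q t) (t', coordCurve d q t t') (deriv (coordCurve d q t) t') w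
          + S.chartForm (q t) (t', coordCurve d q t t') w := by
      filter_upwards [S.T.isOpen.mem_nhds (hT ht)] with t' ht'
      exact S.fderiv_chartLagrangian_velocity _ ht' _ _ _
    rw [e.deriv_eq, (hA.fun_add hB).deriv, S.fderiv_chartLagrangian_position hr _ hp]
    simp [chartEL]
    ring
  constructor
  · rintro ⟨hT, hq, h⟩
    refine ⟨fun s hs => by simpa using hT hs, hq, fun s hs w => ?_⟩
    rw [← key hT hq s hs w, sub_eq_zero]
    exact h s hs w
  · rintro ⟨hT, hq, h⟩
    have hT' : J ⊆ (S.T : Set ℝ) := fun s hs => by simpa using hT s hs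
    refine ⟨hT', hq, fun s hs w => ?_⟩
    have := h s hs w
    rw [← key hT' hq s hs w, sub_eq_zero] at this
    exact this

/-- For `k = 0` time is frozen at `t` and the terms from `b` and `V` vanish; what remains is the
lowered geodesic equation of `a t`. -/
theorem isGeodesicOn_metric_iff (hr : 1 ≤ r) {q : ℝ → Q} {J : Set ℝ} {t : ℝ} (ht : t ∈ S.T) :
    IsGeodesicOn (S.a t) q J ↔ S.IsReducedSolutionOn 0 t q J := by
  have hD : ∀ {q₀ : Q} {z : 𝔼} (_ : z ∈ (extChartAt (𝓡 d) q₀).target) (u v w : 𝔼),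
      fderiv ℝ (fun x => chartComp (S.a t) q₀ x v w) z u
        = fderiv ℝ (S.chartMetric q₀) (t, z) (0, u) v w := by
    intro q₀ z hz u v w
    exact fderiv_metric_position (S.differentiableAt_chartMetric hr (p := (t, z)) ⟨ht, hz⟩) v w u
  have key : ∀ (s : ℝ) (w : 𝔼),
      chartComp (S.a t) (q s) (coordCurve d q s s) (deriv (deriv (coordCurve d q s)) s) w
        + christoffelFirst (S.a t) (q s) (coordCurve d q s s) (deriv (coordCurve d q s) s)
          (deriv (coordCurve d q s) s) w
      = S.chartEL (q s) 0 (0 * s + t, coordCurve d q s s)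
        (deriv (coordCurve d q s) s) (deriv (deriv (coordCurve d q s)) s) w := by
    intro s w
    have hz := coordCurve_mem_target (d := d) q s
    simp only [christoffelFirst, hD hz, chartEL, chartMetric_apply, zero_mul, zero_add]
    ring
  constructor
  · rintro ⟨hq, h⟩
    refine ⟨fun s _ => by simpa using ht, hq, fun s hs w => ?_⟩
    rw [← key]
    exact h s hs w
  · rintro ⟨-, hq, h⟩
    refine ⟨hq, fun s hs w => ?_⟩
    have := h s hs w
    rw [← key] at this
    exact this

end Reduced

/-! ### The fields along a curve -/

section Along

variable (S : MechanicalSystem d Q r)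

/-- The function `b_t(q') - 2 k V_t` along a curve `q`, with `t = k s + c`. -/
def momentum (k c : ℝ) (q : ℝ → Q) (s : ℝ) : ℝ :=
  S.b (k * s + c) (q s) (velocity (𝓡 d) q s) - 2 * k * S.V (k * s + c) (q s)

/-- The partial time derivative of `a_t(q', q') / 2 + k b_t(q') - k² V_t` along a curve `q`,
with `t = k s + c`. -/
def timeForce (k c : ℝ) (q : ℝ → Q) (s : ℝ) : ℝ :=
  deriv (fun t => S.a t (q s) (velocity (𝓡 d) q s) (velocity (𝓡 d) q s) / 2
    + k * S.b t (q s) (velocity (𝓡 d) q s) - k ^ 2 * S.V t (q s)) (k * s + c)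

variable [IsManifold (𝓡 d) 2 Q] {q : ℝ → Q} {J : Set ℝ} {s₀ k c : ℝ}

theorem eventually_momentum_eq (hJ : IsOpen J) (hq : ContMDiffOn 𝓘(ℝ, ℝ) (𝓡 d) 2 q J)
    (hs : s₀ ∈ J) (k c : ℝ) : ∀ᶠ s in 𝓝 s₀, S.momentum k c q s =
      S.chartForm (q s₀) (k * s + c, coordCurve d q s₀ s) (deriv (coordCurve d q s₀) s)
        - 2 * k * S.chartPotential (q s₀) (k * s + c, coordCurve d q s₀ s) := by
  filter_upwards [eventually_apply_velocity hJ hq hs] with s h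
  exact h fun p v => S.b (k * s + c) p v - 2 * k * S.V (k * s + c) p

theorem eventually_timeForce_eq (hr : 1 ≤ r) (hJ : IsOpen J)
    (hq : ContMDiffOn 𝓘(ℝ, ℝ) (𝓡 d) 2 q J) (hs : s₀ ∈ J) (hT : k * s₀ + c ∈ S.T) :
    ∀ᶠ s in 𝓝 s₀, S.timeForce k c q s =
      fderiv ℝ (S.chartMetric (q s₀)) (k * s + c, coordCurve d q s₀ s) (1, 0)
          (deriv (coordCurve d q s₀) s) (deriv (coordCurve d q s₀) s) / 2
        + k * fderiv ℝ (S.chartForm (q s₀)) (k * s + c, coordCurve d q s₀ s) (1, 0)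
          (deriv (coordCurve d q s₀) s)
        - k ^ 2 * fderiv ℝ (S.chartPotential (q s₀)) (k * s + c, coordCurve d q s₀ s) (1, 0) := by
  have hT' : ∀ᶠ s in 𝓝 s₀, k * s + c ∈ S.T :=
    (show Continuous fun s : ℝ => k * s + c by fun_prop).continuousAt.preimage_mem_nhds
      (S.T.isOpen.mem_nhds hT)
  filter_upwards [eventually_apply_velocity hJ hq hs, hT',
    eventually_coordCurve_mem_target hJ hq hs] with s h ht hx
  have hp : (k * s + c, coordCurve d q s₀ s) ∈ S.chartDomain (q s₀) := ⟨ht, hx⟩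
  exact (h fun p v => deriv (fun t => S.a t p v v / 2 + k * S.b t p v - k ^ 2 * S.V t p)
    (k * s + c)).trans (hasDerivAt_lagrangian_time (S.differentiableAt_chartMetric hr hp)
      (S.differentiableAt_chartForm hr hp) (S.differentiableAt_chartPotential hr hp) k _).deriv

theorem contDiffAt_momentum_curve (hr : 1 ≤ r) (hJ : IsOpen J)
    (hq : ContMDiffOn 𝓘(ℝ, ℝ) (𝓡 d) 2 q J) (hs : s₀ ∈ J) (hT : k * s₀ + c ∈ S.T) :
    ContDiffAt ℝ 1 (S.momentum k c q) s₀ := by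
  have hp : S.chartDomain (q s₀) ∈ 𝓝 (k * s₀ + c, coordCurve d q s₀ s₀) :=
    (S.isOpen_chartDomain _).mem_nhds ⟨hT, coordCurve_mem_target q s₀⟩
  exact (contDiffAt_momentum (τ := fun s => k * s + c) ((S.contDiffOn_chartForm hr _).contDiffAt hp)
    ((S.contDiffOn_chartPotential hr _).contDiffAt hp) (by fun_prop)
    ((contDiffAt_coordCurve hJ hq hs).of_le one_le_two)
    (contDiffAt_deriv_coordCurve hJ hq hs) k).congr_of_eventuallyEq
    (S.eventually_momentum_eq hJ hq hs k c)

theorem hasDerivAt_affine (k c s : ℝ) : HasDerivAt (fun s => k * s + c) k s := by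
  simpa using ((hasDerivAt_id s).const_mul k).add_const c

theorem deriv_momentum (hr : 1 ≤ r) (hJ : IsOpen J)
    (hq : ContMDiffOn 𝓘(ℝ, ℝ) (𝓡 d) 2 q J) (hs : s₀ ∈ J) (hT : k * s₀ + c ∈ S.T) :
    deriv (S.momentum k c q) s₀ =
      fderiv ℝ (S.chartForm (q s₀)) (k * s₀ + c, coordCurve d q s₀ s₀)
          (k, deriv (coordCurve d q s₀) s₀) (deriv (coordCurve d q s₀) s₀)
        + S.chartForm (q s₀) (k * s₀ + c, coordCurve d q s₀ s₀)
          (deriv (deriv (coordCurve d q s₀)) s₀)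
        - 2 * k * fderiv ℝ (S.chartPotential (q s₀)) (k * s₀ + c, coordCurve d q s₀ s₀)
          (k, deriv (coordCurve d q s₀) s₀) := by
  have hp : (k * s₀ + c, coordCurve d q s₀ s₀) ∈ S.chartDomain (q s₀) :=
    ⟨hT, coordCurve_mem_target q s₀⟩
  have hx := (eventually_hasDerivAt_coordCurve hJ hq hs).self_of_nhds
  have hτ := hasDerivAt_affine k c s₀
  have h1 := hasDerivAt_form_along (S.differentiableAt_chartForm hr hp) hτ hx
    (hasDerivAt_deriv_coordCurve hJ hq hs)
  have h2 := hasDerivAt_potential_along (S.differentiableAt_chartPotential hr hp) hτ hx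
  exact (Filter.EventuallyEq.deriv_eq (S.eventually_momentum_eq hJ hq hs k c)).trans
    (h1.fun_sub (h2.const_mul (2 * k))).deriv

theorem continuousAt_timeForce (hr : 1 ≤ r) (hJ : IsOpen J)
    (hq : ContMDiffOn 𝓘(ℝ, ℝ) (𝓡 d) 2 q J) (hs : s₀ ∈ J) (hT : k * s₀ + c ∈ S.T) :
    ContinuousAt (S.timeForce k c q) s₀ := by
  have hp : S.chartDomain (q s₀) ∈ 𝓝 (k * s₀ + c, coordCurve d q s₀ s₀) :=
    (S.isOpen_chartDomain _).mem_nhds ⟨hT, coordCurve_mem_target q s₀⟩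
  exact (continuousAt_lagrangian_time (τ := fun s => k * s + c)
    ((S.contDiffOn_chartMetric hr _).contDiffAt hp)
    ((S.contDiffOn_chartForm hr _).contDiffAt hp)
    ((S.contDiffOn_chartPotential hr _).contDiffAt hp) (by fun_prop)
    (contDiffAt_coordCurve hJ hq hs).continuousAt
    (contDiffAt_deriv_coordCurve hJ hq hs).continuousAt k).congr
    (Filter.EventuallyEq.symm (S.eventually_timeForce_eq hr hJ hq hs hT))

end Along

/-! ### Geodesics of the Eisenhart metric -/

section Geodesics

variable (S : MechanicalSystem d Q r)

theorem contMDiffOn_spacetime_iff {γ : ℝ → S.Spacetime} {J : Set ℝ} :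
    ContMDiffOn 𝓘(ℝ, ℝ) (spacetimeModel d) 2 γ J ↔
      ContDiffOn ℝ 2 (fun s => ((γ s).1 : ℝ)) J ∧
        ContMDiffOn 𝓘(ℝ, ℝ) (𝓡 d) 2 (fun s => (γ s).2.1) J ∧
        ContDiffOn ℝ 2 (fun s => (γ s).2.2) J := by
  have h : ContDiffOn ℝ 2 (fun s => ((γ s).1 : ℝ)) J ↔
      ContMDiffOn 𝓘(ℝ, ℝ) 𝓘(ℝ, ℝ) 2 (fun s => (γ s).1) J := by
    rw [← contMDiffOn_iff_contDiffOn]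
    exact forall₂_congr fun s _ => ChartedSpace.liftPropWithinAt_subtypeVal_comp_iff ..
  rw [contMDiffOn_prod_iff, contMDiffOn_prod_iff, h, ← contMDiffOn_iff_contDiffOn]
  rfl

variable [IsManifold (𝓡 d) 2 Q] {γ : ℝ → S.Spacetime} {J : Set ℝ}

/-- The geodesic equation of the Eisenhart metric in coordinates. -/
theorem eisenhart_geodesic_eq (hr : 1 ≤ r) (hJ : IsOpen J)
    (hγ : ContMDiffOn 𝓘(ℝ, ℝ) (spacetimeModel d) 2 γ J) {s : ℝ} (hs : s ∈ J)
    (w : ℝ × 𝔼 × ℝ) {τ y : ℝ → ℝ} {x : ℝ → 𝔼} (hτ : τ = fun s => ((γ s).1 : ℝ))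
    (hx : x = coordCurve d (fun s => (γ s).2.1) s) (hy : y = fun s => (γ s).2.2)
    {A : ℝ × 𝔼 → 𝔼 →L[ℝ] 𝔼 →L[ℝ] ℝ} {B : ℝ × 𝔼 → 𝔼 →L[ℝ] ℝ} {V : ℝ × 𝔼 → ℝ}
    (hA : A = S.chartMetric (γ s).2.1) (hB : B = S.chartForm (γ s).2.1)
    (hV : V = S.chartPotential (γ s).2.1) {cc : ℝ → ℝ × 𝔼 × ℝ}
    (hcc : cc = fun s' => extChartAt (spacetimeModel d) (γ s) (γ s')) :
    chartComp S.eisenhartMetric (γ s) (cc s) (deriv (deriv cc) s) w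
      + christoffelFirst S.eisenhartMetric (γ s) (cc s) (deriv cc s) (deriv cc s) w =
    A (τ s, x s) (deriv (deriv x) s) w.2.1
      - deriv (deriv τ) s * (w.2.2 - B (τ s, x s) w.2.1)
      - (deriv (deriv y) s - B (τ s, x s) (deriv (deriv x) s)) * w.1
      - 2 * V (τ s, x s) * (deriv (deriv τ) s * w.1)
      + (fderiv ℝ A (τ s, x s) (deriv τ s, deriv x s) (deriv x s) w.2.1
        + deriv τ s * fderiv ℝ B (τ s, x s) (deriv τ s, deriv x s) w.2.1
        + w.1 * fderiv ℝ B (τ s, x s) (deriv τ s, deriv x s) (deriv x s)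
        - 2 * fderiv ℝ V (τ s, x s) (deriv τ s, deriv x s) * (deriv τ s * w.1))
      - (fderiv ℝ A (τ s, x s) (w.1, w.2.1) (deriv x s) (deriv x s) / 2
        + deriv τ s * fderiv ℝ B (τ s, x s) (w.1, w.2.1) (deriv x s)
        - fderiv ℝ V (τ s, x s) (w.1, w.2.1) * deriv τ s ^ 2) := by
  have : IsManifold (𝓡 d) 1 Q := IsManifold.of_le (n := 2) one_le_two
  obtain ⟨h1, h2, h3⟩ := S.contMDiffOn_spacetime_iff.1 hγ
  have hz : cc s ∈ (extChartAt (spacetimeModel d) (γ s)).target :=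
    hcc ▸ mem_extChartAt_target (γ s)
  replace hcc : cc = fun s => (τ s, x s, y s) := by subst hcc hτ hx hy; rfl
  have dτ : ContDiffAt ℝ 2 τ s := hτ ▸ h1.contDiffAt (hJ.mem_nhds hs)
  have dy : ContDiffAt ℝ 2 y s := hy ▸ h3.contDiffAt (hJ.mem_nhds hs)
  have dx : ContDiffAt ℝ 2 x s := hx ▸ contDiffAt_coordCurve hJ h2 hs
  have hd : deriv cc =ᶠ[𝓝 s] fun s => (deriv τ s, deriv x s, deriv y s) := by
    filter_upwards [dτ.eventually (by simp), dy.eventually (by simp), dx.eventually (by simp)]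
      with s' e1 e2 e3
    rw [hcc]
    exact ((e1.differentiableAt two_ne_zero).hasDerivAt.prodMk
      ((e3.differentiableAt two_ne_zero).hasDerivAt.prodMk
        (e2.differentiableAt two_ne_zero).hasDerivAt)).deriv
  have hdd : deriv (deriv cc) s = (deriv (deriv τ) s, deriv (deriv x) s, deriv (deriv y) s) := by
    rw [hd.deriv_eq]
    have e1 : ContDiffAt ℝ 1 (deriv τ) s := dτ.derivWithin (m := 1) (by norm_num)
    have e2 : ContDiffAt ℝ 1 (deriv y) s := dy.derivWithin (m := 1) (by norm_num)
    have e3 : ContDiffAt ℝ 1 (deriv x) s := dx.derivWithin (m := 1) (by norm_num)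
    exact ((e1.differentiableAt one_ne_zero).hasDerivAt.prodMk
      ((e3.differentiableAt one_ne_zero).hasDerivAt.prodMk
        (e2.differentiableAt one_ne_zero).hasDerivAt)).deriv
  have hp : (τ s, x s) ∈ S.chartDomain (γ s).2.1 := by
    have := S.mem_target_spacetime.1 hz
    rw [hcc] at this
    exact this
  have hD : ∀ u v w : ℝ × 𝔼 × ℝ,
      fderiv ℝ (fun z => chartComp S.eisenhartMetric (γ s) z v w) (cc s) u =
        fderiv ℝ A (τ s, x s) (u.1, u.2.1) v.2.1 w.2.1
        + v.1 * fderiv ℝ B (τ s, x s) (u.1, u.2.1) w.2.1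
        + w.1 * fderiv ℝ B (τ s, x s) (u.1, u.2.1) v.2.1
        - 2 * fderiv ℝ V (τ s, x s) (u.1, u.2.1) * (v.1 * w.1) := by
    intro u v w
    -- The explicit components hold only on the chart target, which is open, so they may be
    -- differentiated there.
    have e := Filter.eventuallyEq_of_mem ((isOpen_extChartAt_target (γ s)).mem_nhds hz)
      fun z hz => S.chartComp_eisenhartMetric hz v w
    rw [e.fderiv_eq, hcc]
    subst hA hB hV
    exact fderiv_brinkmann (z := (τ s, x s, y s)) (S.differentiableAt_chartMetric hr hp)
      (S.differentiableAt_chartForm hr hp) (S.differentiableAt_chartPotential hr hp) u v w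
  simp only [christoffelFirst, hD, S.chartComp_eisenhartMetric hz, hdd, hd.eq_of_nhds]
  simp only [hcc, ← hA, ← hB, ← hV]
  ring

/-- Once `t'' = 0`, the equation tested on `w` is `chartEL` at the `Q` part of `w` plus `w.1` times
an expression in which `y''` has coefficient `-1`. The unknowns `q` and `y` are thereby decoupled.
-/
theorem isGeodesicOn_eisenhartMetric_iff (hr : 1 ≤ r) (hJ : IsOpen J) {k c : ℝ}
    (ht : ∀ s ∈ J, ((γ s).1 : ℝ) = k * s + c) :
    IsGeodesicOn S.eisenhartMetric γ J ↔
      S.IsReducedSolutionOn k c (fun s => (γ s).2.1) J ∧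
      ContDiffOn ℝ 2 (fun s => (γ s).2.2) J ∧
      ∀ s ∈ J, deriv (deriv fun s => (γ s).2.2) s =
        deriv (S.momentum k c fun s => (γ s).2.1) s - S.timeForce k c (fun s => (γ s).2.1) s := by
  have hT : ∀ s ∈ J, k * s + c ∈ S.T := fun s hs => ht s hs ▸ (γ s).1.2
  have key : ContMDiffOn 𝓘(ℝ, ℝ) (spacetimeModel d) 2 γ J → ∀ s ∈ J, ∀ w : ℝ × 𝔼 × ℝ,
      (let cc : ℝ → ℝ × 𝔼 × ℝ := fun s' => extChartAt (spacetimeModel d) (γ s) (γ s')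
       chartComp S.eisenhartMetric (γ s) (cc s) (deriv (deriv cc) s) w
        + christoffelFirst S.eisenhartMetric (γ s) (cc s) (deriv cc s) (deriv cc s) w) =
      S.chartEL (γ s).2.1 k (k * s + c, coordCurve d (fun s => (γ s).2.1) s s)
        (deriv (coordCurve d (fun s => (γ s).2.1) s) s)
        (deriv (deriv (coordCurve d (fun s => (γ s).2.1) s)) s) w.2.1
      + w.1 * (deriv (S.momentum k c fun s => (γ s).2.1) s
        - S.timeForce k c (fun s => (γ s).2.1) s - deriv (deriv fun s => (γ s).2.2) s) := by
    intro hγ s hs w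
    have h2 := (S.contMDiffOn_spacetime_iff.1 hγ).2.1
    have hev : (fun s => ((γ s).1 : ℝ)) =ᶠ[𝓝 s] fun s => k * s + c :=
      Filter.eventuallyEq_of_mem (hJ.mem_nhds hs) ht
    have hd : deriv (fun s => ((γ s).1 : ℝ)) =ᶠ[𝓝 s] fun _ => k := by
      refine hev.deriv.trans (Filter.Eventually.of_forall fun s => ?_)
      exact (hasDerivAt_affine k c s).deriv
    -- Splitting the direction separates the pure time derivatives, which make up `timeForce`, from
    -- the position derivatives in `chartEL`.
    have hw : (w.1, w.2.1) = w.1 • ((1 : ℝ), (0 : 𝔼)) + (0, w.2.1) := by simp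
    refine (S.eisenhart_geodesic_eq hr hJ hγ hs w rfl rfl rfl rfl rfl rfl rfl).trans ?_
    rw [S.deriv_momentum hr hJ h2 hs (hT s hs),
      (S.eventually_timeForce_eq hr hJ h2 hs (hT s hs)).self_of_nhds, hd.deriv_eq,
      hd.eq_of_nhds, hw]
    simp only [map_add, map_smul, add_apply, smul_apply, smul_eq_mul, chartEL, deriv_const, ht s hs]
    ring
  constructor
  · rintro ⟨hγ, h⟩
    obtain ⟨-, h2, h3⟩ := S.contMDiffOn_spacetime_iff.1 hγ
    refine ⟨⟨hT, h2, fun s hs w => ?_⟩, h3, fun s hs => ?_⟩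
    · simpa using (key hγ s hs (0, w, 0)).symm.trans (h s hs (0, w, 0))
    · have := (key hγ s hs (1, 0, 0)).symm.trans (h s hs (1, 0, 0))
      simp [chartEL, Prod.mk_zero_zero] at this
      linarith
  · rintro ⟨⟨-, h2, h⟩, h3, hy⟩
    have hγ : ContMDiffOn 𝓘(ℝ, ℝ) (spacetimeModel d) 2 γ J :=
      S.contMDiffOn_spacetime_iff.2 ⟨ContDiffOn.congr (by fun_prop) ht, h2, h3⟩
    refine ⟨hγ, fun s hs w => (key hγ s hs w).trans ?_⟩
    rw [h s hs, hy s hs]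
    ring

/-- The time is an affine function along a geodesic. -/
theorem exists_time_eq_affine (hr : 1 ≤ r) (hJ : IsOpen J) (hJc : J.OrdConnected)
    (h : IsGeodesicOn S.eisenhartMetric γ J) :
    ∃ k c : ℝ, ∀ s ∈ J, ((γ s).1 : ℝ) = k * s + c := by
  obtain ⟨h1, -, -⟩ := S.contMDiffOn_spacetime_iff.1 h.1
  have hdd : ∀ s ∈ J, deriv (deriv fun s => ((γ s).1 : ℝ)) s = 0 := by
    intro s hs
    -- Testing with `∂_y` leaves only `-t''`.
    have e := (S.eisenhart_geodesic_eq hr hJ h.1 hs (0, 0, 1) rfl rfl rfl rfl rfl rfl rfl).symm.trans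
      (h.2 s hs (0, 0, 1))
    simp only [map_zero, mul_zero] at e
    rw [show ((0 : ℝ), (0 : 𝔼)) = 0 from rfl] at e
    simpa using e
  have hd : DifferentiableOn ℝ (deriv fun s => ((γ s).1 : ℝ)) J :=
    ((contDiffOn_succ_iff_deriv_of_isOpen (n := 1) hJ).1 h1).2.2.differentiableOn one_ne_zero
  obtain ⟨k, hk⟩ := hJ.exists_is_const_of_deriv_eq_zero hJc.isPreconnected hd hdd
  have hd' : ∀ s ∈ J, HasDerivAt (fun s => ((γ s).1 : ℝ) - k * s) 0 s := by
    intro s hs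
    have e := ((h1.contDiffAt (hJ.mem_nhds hs)).differentiableAt two_ne_zero).hasDerivAt
    rw [hk s hs] at e
    simpa using e.fun_sub ((hasDerivAt_id s).const_mul k)
  obtain ⟨c, hc⟩ := hJ.exists_is_const_of_deriv_eq_zero hJc.isPreconnected
    (fun s hs => (hd' s hs).differentiableAt.differentiableWithinAt) fun s hs => (hd' s hs).deriv
  exact ⟨k, c, fun s hs => by linarith [hc s hs]⟩

end Geodesics

end MechanicalSystem

/-! ### Functions of one variable on an interval -/

section Interval

variable {J : Set ℝ} {s₀ : ℝ}

theorem hasDerivAt_integral_of_continuousOn (hJ : IsOpen J) (hJc : J.OrdConnected) {f : ℝ → ℝ}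
    (hf : ContinuousOn f J) (hs₀ : s₀ ∈ J) {s : ℝ} (hs : s ∈ J) :
    HasDerivAt (fun u => ∫ x in s₀..u, f x) (f s) s :=
  intervalIntegral.integral_hasDerivAt_right
    (hf.mono (hJc.uIcc_subset hs₀ hs)).intervalIntegrable
    (hf.stronglyMeasurableAtFilter hJ s hs) (hf.continuousAt (hJ.mem_nhds hs))

theorem contDiffOn_succ_of_hasDerivAt (hJ : IsOpen J) {f f' : ℝ → ℝ}
    (hf : ∀ s ∈ J, HasDerivAt f (f' s) s) {n : ℕ} (hf' : ContDiffOn ℝ n f' J) :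
    ContDiffOn ℝ (n + 1) f J :=
  (contDiffOn_succ_iff_deriv_of_isOpen hJ).2
    ⟨fun s hs => (hf s hs).differentiableAt.differentiableWithinAt, by simp,
      hf'.congr fun s hs => (hf s hs).deriv⟩

/-- Solution of `y'' = F' - R` with given initial values. -/
theorem exists_second_primitive (hJ : IsOpen J) (hJc : J.OrdConnected) (hs₀ : s₀ ∈ J)
    {F R : ℝ → ℝ} (hF : ContDiffOn ℝ 1 F J) (hR : ContinuousOn R J) (y₀ y₁ : ℝ) :
    ∃ y : ℝ → ℝ, ContDiffOn ℝ 2 y J ∧ (∀ s ∈ J, deriv (deriv y) s = deriv F s - R s) ∧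
      y s₀ = y₀ ∧ deriv y s₀ = y₁ := by
  set P : ℝ → ℝ := fun u => ∫ x in s₀..u, R x with hP
  have dP : ∀ s ∈ J, HasDerivAt P (R s) s := fun s hs =>
    hasDerivAt_integral_of_continuousOn hJ hJc hR hs₀ hs
  -- This is the future `y'`; since `P s₀ = 0`, the constant gives it the value `y₁` at `s₀`.
  set h : ℝ → ℝ := fun s => F s + (y₁ - F s₀) - P s with hh
  have cP : ContDiffOn ℝ 1 P J := by
    simpa using contDiffOn_succ_of_hasDerivAt hJ dP (n := 0) (by simpa using hR)
  have ch : ContDiffOn ℝ 1 h J := (hF.add contDiffOn_const).sub cP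
  set y : ℝ → ℝ := fun u => y₀ + ∫ x in s₀..u, h x with hy
  have dy : ∀ s ∈ J, HasDerivAt y (h s) s := fun s hs =>
    (hasDerivAt_integral_of_continuousOn hJ hJc ch.continuousOn hs₀ hs).const_add y₀
  refine ⟨y, ?_, fun s hs => ?_, ?_, ?_⟩
  · have := contDiffOn_succ_of_hasDerivAt hJ dy (n := 1) (by simpa using ch)
    norm_num at this
    exact this
  · have e : deriv y =ᶠ[𝓝 s] h := Filter.eventuallyEq_of_mem (hJ.mem_nhds hs)
      fun s hs => (dy s hs).deriv
    have dF := ((hF.contDiffAt (hJ.mem_nhds hs)).differentiableAt one_ne_zero).hasDerivAt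
    rw [e.deriv_eq]
    exact ((dF.add_const _).fun_sub (dP s hs)).deriv
  · simp [hy]
  · simp [(dy s₀ hs₀).deriv, hh, hP]

theorem eqOn_of_deriv_deriv_eq (hJ : IsOpen J) (hJc : J.OrdConnected) (hs₀ : s₀ ∈ J)
    {y z : ℝ → ℝ} (hy : ContDiffOn ℝ 2 y J) (hz : ContDiffOn ℝ 2 z J)
    (h : ∀ s ∈ J, deriv (deriv y) s = deriv (deriv z) s) (h0 : y s₀ = z s₀)
    (h1 : deriv y s₀ = deriv z s₀) : EqOn y z J := by
  have dd : ∀ {y : ℝ → ℝ}, ContDiffOn ℝ 2 y J → DifferentiableOn ℝ (deriv y) J := fun hy =>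
    ((contDiffOn_succ_iff_deriv_of_isOpen (n := 1) hJ).1 hy).2.2.differentiableOn one_ne_zero
  have e1 := hJ.eqOn_of_deriv_eq hJc.isPreconnected (dd hy) (dd hz) h hs₀ h1
  exact hJ.eqOn_of_deriv_eq hJc.isPreconnected (hy.differentiableOn two_ne_zero)
    (hz.differentiableOn two_ne_zero) e1 hs₀ h0

theorem affine_coeff_eq (hJ : IsOpen J) (hs₀ : s₀ ∈ J) {k c k' c' : ℝ}
    (h : ∀ s ∈ J, k * s + c = k' * s + c') : k = k' ∧ c = c' := by
  have e : (fun s => k * s + c) =ᶠ[𝓝 s₀] fun s => k' * s + c' :=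
    Filter.eventuallyEq_of_mem (hJ.mem_nhds hs₀) h
  have hk : k = k' := by
    have := e.deriv_eq
    rwa [(MechanicalSystem.hasDerivAt_affine k c s₀).deriv,
      (MechanicalSystem.hasDerivAt_affine k' c' s₀).deriv] at this
  subst hk
  exact ⟨rfl, by linarith [h s₀ hs₀]⟩

theorem Set.OrdConnected.preimage_affine (hJc : J.OrdConnected) (m n : ℝ) :
    ((fun s => m * s + n) ⁻¹' J).OrdConnected := by
  rcases le_total 0 m with hm | hm
  · exact hJc.preimage_mono fun s t h => by simpa using mul_le_mul_of_nonneg_left h hm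
  · exact hJc.preimage_anti fun s t h => by simpa using mul_le_mul_of_nonpos_left h hm

end Interval

namespace MechanicalSystem

variable {d : ℕ} {Q : Type*} [TopologicalSpace Q] [ChartedSpace (EuclideanSpace ℝ (Fin d)) Q]
  {r : WithTop ℕ∞}

local notation "𝔼" => EuclideanSpace ℝ (Fin d)

/-! ### Affine changes of parameter in the reduced equation -/

section Reparametrization

variable (S : MechanicalSystem d Q r)

theorem deriv_comp_affine {E : Type*} [NormedAddCommGroup E] [NormedSpace ℝ E] (f : ℝ → E)
    (m n : ℝ) : deriv (fun s => f (m * s + n)) = fun s => m • deriv f (m * s + n) := by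
  funext s
  rw [deriv_comp_mul_left m (fun s => f (s + n)), deriv_comp_add_const]

/-- Every term is either linear in the acceleration or quadratic in `(k, v)`. -/
theorem chartEL_smul (q₀ : Q) (k m : ℝ) (p : ℝ × 𝔼) (v z w : 𝔼) :
    S.chartEL q₀ (k * m) p (m • v) (m • m • z) w = m ^ 2 * S.chartEL q₀ k p v z w := by
  have h : (k * m, m • v) = m • (k, v) := by simp [mul_comm]
  simp only [chartEL, h, map_smul, smul_apply, smul_eq_mul]
  ring

theorem IsReducedSolutionOn.comp_affine {S : MechanicalSystem d Q r} {k c : ℝ} {q : ℝ → Q}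
    {J : Set ℝ} (h : S.IsReducedSolutionOn k c q J) (m n : ℝ) :
    S.IsReducedSolutionOn (k * m) (k * n + c) (fun s => q (m * s + n))
      ((fun s => m * s + n) ⁻¹' J) := by
  have e : ∀ s, k * m * s + (k * n + c) = k * (m * s + n) + c := fun s => by ring
  refine ⟨fun s hs => e s ▸ h.mem _ hs, ?_, fun s hs w => ?_⟩
  · have ha : ContMDiff 𝓘(ℝ, ℝ) 𝓘(ℝ, ℝ) 2 fun s : ℝ => m * s + n :=
      ContDiff.contMDiff (by fun_prop)
    exact h.contMDiffOn.comp ha.contMDiffOn fun s hs => hs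
  · have hc : coordCurve d (fun s => q (m * s + n)) s =
      fun u => coordCurve d q (m * s + n) (m * u + n) := rfl
    have hd := deriv_comp_affine (coordCurve d q (m * s + n)) m n
    rw [hc, hd, deriv_fun_const_smul_field, deriv_comp_affine, e, S.chartEL_smul, h.eq_zero _ hs,
      mul_zero]

/-- The potential force carries the factor `k ^ 2`, so at `k = 0` nothing moves a point at rest.
This handles causal geodesics with constant time. -/
theorem isReducedSolutionOn_const {t : ℝ} (ht : t ∈ S.T) (q₀ : Q) (J : Set ℝ) :
    S.IsReducedSolutionOn 0 t (fun _ => q₀) J := by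
  refine ⟨fun s _ => by simpa using ht, contMDiffOn_const, fun s _ w => ?_⟩
  have hc : coordCurve d (fun _ : ℝ => q₀) s = fun _ => extChartAt (𝓡 d) q₀ q₀ := rfl
  simp [hc, chartEL]

end Reparametrization

/-! ### Lifting reduced solutions to geodesics and extending geodesics -/

section Lift

variable (S : MechanicalSystem d Q r) [IsManifold (𝓡 d) 2 Q] {J : Set ℝ} {s₀ : ℝ}

/-- A solution of the reduced equation lifts to a geodesic of the spacetime. -/
theorem exists_geodesic_lift (hr : 1 ≤ r) (hJ : IsOpen J) (hJc : J.OrdConnected) (hs₀ : s₀ ∈ J)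
    {k c : ℝ} {q : ℝ → Q} (h : S.IsReducedSolutionOn k c q J) (y₀ y₁ : ℝ) :
    ∃ γ : ℝ → S.Spacetime, IsGeodesicOn S.eisenhartMetric γ J ∧
      (∀ s ∈ J, ((γ s).1 : ℝ) = k * s + c) ∧ (∀ s, (γ s).2.1 = q s) ∧
      (γ s₀).2.2 = y₀ ∧ deriv (fun s => (γ s).2.2) s₀ = y₁ := by
  classical
  obtain ⟨y, hy, hdd, h0, h1⟩ := exists_second_primitive (F := S.momentum k c q)
    (R := S.timeForce k c q) hJ hJc hs₀
    (fun s hs => (S.contDiffAt_momentum_curve hr hJ h.contMDiffOn hs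
      (h.mem s hs)).contDiffWithinAt)
    (fun s hs => (S.continuousAt_timeForce hr hJ h.contMDiffOn hs
      (h.mem s hs)).continuousWithinAt) y₀ y₁
  -- Outside `J` the affine time may leave `T`; the value chosen there is arbitrary.
  let γ : ℝ → S.Spacetime := fun s =>
    (if hs : k * s + c ∈ S.T then ⟨k * s + c, hs⟩ else ⟨k * s₀ + c, h.mem s₀ hs₀⟩, q s, y s)
  have ht : ∀ s ∈ J, ((γ s).1 : ℝ) = k * s + c := fun s hs => by simp [γ, h.mem s hs]
  exact ⟨γ, (S.isGeodesicOn_eisenhartMetric_iff hr hJ ht).2 ⟨h, hy, hdd⟩, ht, fun _ => rfl, h0, h1⟩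

/-- A geodesic of the spacetime extends as soon as its projection to `Q` does. -/
theorem exists_geodesic_extension (hr : 1 ≤ r) (hJ : IsOpen J) (hJc : J.OrdConnected)
    (hs₀ : s₀ ∈ J) {k c : ℝ} {γ : ℝ → S.Spacetime} (hγ : IsGeodesicOn S.eisenhartMetric γ J)
    (ht : ∀ s ∈ J, ((γ s).1 : ℝ) = k * s + c) {q : ℝ → Q}
    (h : S.IsReducedSolutionOn k c q univ) (hq : EqOn q (fun s => (γ s).2.1) J) :
    ∃ γ' : ℝ → S.Spacetime, IsGeodesicOn S.eisenhartMetric γ' univ ∧ EqOn γ' γ J := by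
  -- The lift takes its height and slope at `s₀` from `γ`, so that the two heights can be identified
  -- on `J`.
  obtain ⟨γ', hγ', ht', hq', h0, h1⟩ := S.exists_geodesic_lift hr isOpen_univ ordConnected_univ
    (mem_univ s₀) h (γ s₀).2.2 (deriv (fun s => (γ s).2.2) s₀)
  refine ⟨γ', hγ', fun s hs => ?_⟩
  obtain ⟨-, hy, hdd⟩ := (S.isGeodesicOn_eisenhartMetric_iff hr hJ ht).1 hγ
  obtain ⟨-, hy', hdd'⟩ := (S.isGeodesicOn_eisenhartMetric_iff hr isOpen_univ ht').1 hγ'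
  have hqe : ∀ s ∈ J, (fun s => (γ' s).2.1) =ᶠ[𝓝 s] fun s => (γ s).2.1 := fun s hs =>
    Filter.eventuallyEq_of_mem (hJ.mem_nhds hs) fun s hs => (hq' s).trans (hq hs)
  have hm : ∀ s ∈ J, S.momentum k c (fun s => (γ' s).2.1) s
      = S.momentum k c (fun s => (γ s).2.1) s := fun s hs =>
    velocity_congr (hqe s hs) fun p v => S.b (k * s + c) p v - 2 * k * S.V (k * s + c) p
  have hf : ∀ s ∈ J, S.timeForce k c (fun s => (γ' s).2.1) s
      = S.timeForce k c (fun s => (γ s).2.1) s := fun s hs =>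
    velocity_congr (hqe s hs) fun p v =>
      deriv (fun t => S.a t p v v / 2 + k * S.b t p v - k ^ 2 * S.V t p) (k * s + c)
  -- Both heights have the same second derivative, because `momentum` and `timeForce` depend only on
  -- the germ of the projected curve.
  have he : EqOn (fun s => (γ' s).2.2) (fun s => (γ s).2.2) J := by
    refine eqOn_of_deriv_deriv_eq hJ hJc hs₀ (hy'.mono (subset_univ J)) hy (fun s hs => ?_) h0 h1
    rw [hdd s hs, hdd' s (mem_univ s), hf s hs,
      (Filter.eventuallyEq_of_mem (hJ.mem_nhds hs) hm).deriv_eq]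
  exact Prod.ext (Subtype.ext ((ht' s (mem_univ s)).trans (ht s hs).symm))
    (Prod.ext ((hq' s).trans (hq hs)) (he hs))

end Lift

/-! ### The square of the velocity and curves of zero velocity -/

section Velocity

variable (S : MechanicalSystem d Q r) {J : Set ℝ} {γ : ℝ → S.Spacetime}

theorem dt_velocity {s : ℝ} (hγ : MDifferentiableAt 𝓘(ℝ, ℝ) (spacetimeModel d) γ s) :
    S.dt (γ s) (velocity (spacetimeModel d) γ s) = deriv (fun s => ((γ s).1 : ℝ)) s := by
  refine (mfderiv_comp_apply s (S.mdifferentiableAt_time (γ s)) hγ (1 : ℝ)).symm.trans ?_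
  rw [mfderiv_eq_fderiv]
  rfl

theorem dy_velocity {s : ℝ} (hγ : MDifferentiableAt 𝓘(ℝ, ℝ) (spacetimeModel d) γ s) :
    S.dy (γ s) (velocity (spacetimeModel d) γ s) = deriv (fun s => (γ s).2.2) s := by
  refine (mfderiv_comp_apply s (S.mdifferentiableAt_height (γ s)) hγ (1 : ℝ)).symm.trans ?_
  rw [mfderiv_eq_fderiv]
  rfl

theorem dq_velocity {s : ℝ} (hγ : MDifferentiableAt 𝓘(ℝ, ℝ) (spacetimeModel d) γ s) :
    S.dq (γ s) (velocity (spacetimeModel d) γ s) = velocity (𝓡 d) (fun s => (γ s).2.1) s :=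
  (mfderiv_comp_apply s (S.mdifferentiableAt_position (γ s)) hγ (1 : ℝ)).symm

/-- Writing `b_t(q')` through `momentum` is what lets the square be differentiated: the derivative
of `momentum` then cancels against the one in `y''`. -/
theorem eisenhartMetric_velocity (hJ : IsOpen J)
    (hγ : ContMDiffOn 𝓘(ℝ, ℝ) (spacetimeModel d) 2 γ J) {k c : ℝ}
    (ht : ∀ s ∈ J, ((γ s).1 : ℝ) = k * s + c) {s : ℝ} (hs : s ∈ J) :
    S.eisenhartMetric (γ s) (velocity (spacetimeModel d) γ s) (velocity (spacetimeModel d) γ s)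
      = S.a (k * s + c) (γ s).2.1 (velocity (𝓡 d) (fun s => (γ s).2.1) s)
          (velocity (𝓡 d) (fun s => (γ s).2.1) s)
        + 2 * k * S.momentum k c (fun s => (γ s).2.1) s
        + 2 * k ^ 2 * S.V (k * s + c) (γ s).2.1 - 2 * k * deriv (fun s => (γ s).2.2) s := by
  have hm := (hγ.contMDiffAt (hJ.mem_nhds hs)).mdifferentiableAt two_ne_zero
  have hk : deriv (fun s => ((γ s).1 : ℝ)) s = k := by
    have e : (fun s => ((γ s).1 : ℝ)) =ᶠ[𝓝 s] fun s => k * s + c :=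
      Filter.eventuallyEq_of_mem (hJ.mem_nhds hs) ht
    rw [e.deriv_eq, (hasDerivAt_affine k c s).deriv]
  have e1 := S.dt_velocity hm
  have e2 := S.dy_velocity hm
  have e3 := S.dq_velocity hm
  rw [hk] at e1
  simp only [eisenhartMetric, LinearMap.mk₂_apply, dyb, sub_apply,
    ContinuousLinearMap.comp_apply, momentum]
  rw [e1, e2, e3, ht s hs]
  ring

variable [IsManifold (𝓡 d) 2 Q]

/-- The square of the velocity is constant along a geodesic. -/
theorem exists_eisenhartMetric_velocity_eq (hr : 1 ≤ r) (hJ : IsOpen J) (hJc : J.OrdConnected)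
    (hγ : IsGeodesicOn S.eisenhartMetric γ J) {k c : ℝ}
    (ht : ∀ s ∈ J, ((γ s).1 : ℝ) = k * s + c) :
    ∃ n : ℝ, ∀ s ∈ J, S.eisenhartMetric (γ s) (velocity (spacetimeModel d) γ s)
      (velocity (spacetimeModel d) γ s) = n := by
  obtain ⟨h, hy, hdd⟩ := (S.isGeodesicOn_eisenhartMetric_iff hr hJ ht).1 hγ
  set q : ℝ → Q := fun s => (γ s).2.1
  set y : ℝ → ℝ := fun s => (γ s).2.2
  let N : ℝ → ℝ := fun s => S.a (k * s + c) (q s) (velocity (𝓡 d) q s) (velocity (𝓡 d) q s)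
        + 2 * k * S.momentum k c q s + 2 * k ^ 2 * S.V (k * s + c) (q s) - 2 * k * deriv y s
  have hN : ∀ s ∈ J, HasDerivAt N 0 s := by
    intro s hs
    have hq := h.contMDiffOn
    have hp : (k * s + c, coordCurve d q s s) ∈ S.chartDomain (q s) :=
      ⟨h.mem s hs, coordCurve_mem_target q s⟩
    have hx := (eventually_hasDerivAt_coordCurve hJ hq hs).self_of_nhds
    have hτ := hasDerivAt_affine k c s
    have hx' := hasDerivAt_deriv_coordCurve hJ hq hs
    have d1 := hasDerivAt_metric_along (S.differentiableAt_chartMetric hr hp) hτ hx hx' hx'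
    have d2 := hasDerivAt_potential_along (S.differentiableAt_chartPotential hr hp) hτ hx
    have d3 := ((S.contDiffAt_momentum_curve hr hJ hq hs
      (h.mem s hs)).differentiableAt one_ne_zero).hasDerivAt
    have d4 := (((contDiffOn_succ_iff_deriv_of_isOpen (n := 1) hJ).1 hy).2.2.differentiableOn
      one_ne_zero).hasDerivAt (hJ.mem_nhds hs)
    have e : N =ᶠ[𝓝 s] fun u => S.chartMetric (q s) (k * u + c, coordCurve d q s u)
          (deriv (coordCurve d q s) u) (deriv (coordCurve d q s) u)
        + 2 * k * S.momentum k c q u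
        + 2 * k ^ 2 * S.chartPotential (q s) (k * u + c, coordCurve d q s u)
        - 2 * k * deriv y u := by
      filter_upwards [eventually_apply_velocity hJ hq hs] with u hu
      have e1 := hu fun p v => S.a (k * u + c) p v v
      have e2 := hu fun p _ => S.V (k * u + c) p
      simp only [N, e1, e2]
      rfl
    refine HasDerivAt.congr_of_eventuallyEq ?_ e
    refine (((d1.fun_add (d3.const_mul (2 * k))).fun_add (d2.const_mul (2 * k ^ 2))).fun_sub
      (d4.const_mul (2 * k))).congr_deriv ?_
    -- The reduced equation tested on the velocity itself: the derivative of `N` is twice its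
    -- left-hand side.
    have hE := h.eq_zero s hs (deriv (coordCurve d q s) s)
    have hw : (k, deriv (coordCurve d q s) s)
      = k • ((1 : ℝ), (0 : 𝔼)) + (0, deriv (coordCurve d q s) s) := by simp
    rw [hdd s hs, (S.eventually_timeForce_eq hr hJ hq hs (h.mem s hs)).self_of_nhds,
      S.chartMetric_symm (h.mem s hs) (deriv (coordCurve d q s) s), hw]
    simp only [chartEL, hw, map_add, map_smul, add_apply, smul_apply, smul_eq_mul] at hE ⊢
    linear_combination 2 * hE
  obtain ⟨n, hn⟩ := hJ.exists_is_const_of_deriv_eq_zero hJc.isPreconnected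
    (fun s hs => (hN s hs).differentiableAt.differentiableWithinAt) fun s hs => (hN s hs).deriv
  exact ⟨n, fun s hs => (S.eisenhartMetric_velocity hJ hγ.1 ht hs).trans (hn s hs)⟩

/-- A curve with zero velocity is constant. -/
theorem eqOn_const_of_velocity_eq_zero (hJ : IsOpen J) (hJc : J.OrdConnected) {q : ℝ → Q}
    (hq : ContMDiffOn 𝓘(ℝ, ℝ) (𝓡 d) 2 q J) (h : ∀ s ∈ J, velocity (𝓡 d) q s = 0) {s₀ s : ℝ}
    (hs₀ : s₀ ∈ J) (hs : s ∈ J) : q s₀ = q s := by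
  have : IsManifold (𝓡 d) 1 Q := IsManifold.of_le (n := 2) one_le_two
  -- Connectedness of `J` reduces the claim to local constancy, which is proved in a chart on a
  -- small ball of parameters.
  refine hJc.isPreconnected.induction₂ (fun s u => q s = q u) (fun s hs => ?_)
    (fun _ _ _ _ _ _ => Eq.trans) (fun _ _ _ _ => Eq.symm) hs₀ hs
  refine nhdsWithin_le_nhds ?_
  have hsrc := (hq.contMDiffAt (hJ.mem_nhds hs)).continuousAt.preimage_mem_nhds
    ((chartAt 𝔼 (q s)).open_source.mem_nhds (mem_chart_source _ (q s)))
  have hd : ∀ᶠ u in 𝓝 s, HasDerivAt (coordCurve d q s) 0 u := by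
    filter_upwards [eventually_hasDerivAt_coordCurve hJ hq hs, hJ.mem_nhds hs, hsrc]
      with u h1 hu h2
    have e := mfderiv_comp_apply u (mdifferentiableAt_extChartAt (I := 𝓡 d) h2)
      ((hq.contMDiffAt (hJ.mem_nhds hu)).mdifferentiableAt two_ne_zero) (1 : ℝ)
    have h0 : mfderiv 𝓘(ℝ, ℝ) (𝓡 d) q u (1 : ℝ) = 0 := h u hu
    have e' : fderiv ℝ (coordCurve d q s) u 1 = 0 := by
      rw [← mfderiv_eq_fderiv]
      refine e.trans ?_
      rw [h0, map_zero]
      rfl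
    have e'' : deriv (coordCurve d q s) u = 0 := e'
    rwa [e''] at h1
  obtain ⟨ε, hε, hb⟩ := Metric.eventually_nhds_iff_ball.1
    (hd.and (eventually_symm_coordCurve hJ hq hs))
  filter_upwards [Metric.ball_mem_nhds s hε] with u hu
  have hx : coordCurve d q s u = coordCurve d q s s :=
    Metric.isOpen_ball.is_const_of_deriv_eq_zero (convex_ball s ε).isPreconnected
      (fun u hu => (hb u hu).1.differentiableAt.differentiableWithinAt)
      (fun u hu => (hb u hu).1.deriv) hu (Metric.mem_ball_self hε)
  exact (hb s (Metric.mem_ball_self hε)).2.symm.trans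
    ((congrArg (extChartAt (𝓡 d) (q s)).symm hx.symm).trans (hb u hu).2)

end Velocity

/-! ### Transfer of completeness between the flow, the metrics `a_t` and the spacetime -/

section Completeness

/-- If the Euler-Lagrange flow is complete then every solution of the reduced equation with
`t' ≠ 0` extends. -/
theorem ELFlowComplete.exists_extension {S : MechanicalSystem d Q r} (hr : 1 ≤ r)
    (hS : S.ELFlowComplete) {J : Set ℝ} (hJ : IsOpen J) (hJc : J.OrdConnected) {s₀ : ℝ}
    (hs₀ : s₀ ∈ J) {k c : ℝ} (hk : k ≠ 0) {q : ℝ → Q} (h : S.IsReducedSolutionOn k c q J) :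
    ∃ q' : ℝ → Q, S.IsReducedSolutionOn k c q' univ ∧ EqOn q' q J := by
  -- The new parameter is the time `k s + c` itself, which turns `(k, c)` into `(1, 0)`.
  have h1 := h.comp_affine k⁻¹ (-(k⁻¹ * c))
  have e1 : k * k⁻¹ = 1 := mul_inv_cancel₀ hk
  have e2 : k * -(k⁻¹ * c) + c = 0 := by linear_combination (-c) * e1
  rw [e1, e2] at h1
  have e3 : ∀ s, k⁻¹ * (k * s + c) + -(k⁻¹ * c) = s := fun s => by linear_combination s * e1
  have hJo : IsOpen ((fun s => k⁻¹ * s + -(k⁻¹ * c)) ⁻¹' J) := hJ.preimage (by fun_prop)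
  obtain ⟨q', hq', he⟩ := hS _ _ hJo (hJc.preimage_affine _ _)
    ⟨k * s₀ + c, by simpa only [mem_preimage, e3] using hs₀⟩ ((S.isELSolutionOn_iff hr hJo).2 h1)
  have h2 := ((S.isELSolutionOn_iff hr isOpen_univ).1 hq').comp_affine k c
  simp only [one_mul, add_zero, preimage_univ] at h2
  refine ⟨_, h2, fun s hs => ?_⟩
  have := he (x := k * s + c) (by simpa only [mem_preimage, e3] using hs)
  simpa only [e3] using this

variable (S : MechanicalSystem d Q r) [IsManifold (𝓡 d) 2 Q]

/-- If `k ≠ 0` the flow extends the projection. If `k = 0` the causal condition reads `a_c(q', q') ≤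
0`, and positivity makes `q` constant. -/
theorem ELFlowComplete.causallyGeodesicallyComplete {S : MechanicalSystem d Q r} (hr : 1 ≤ r)
    (hS : S.ELFlowComplete) : CausallyGeodesicallyComplete S.eisenhartMetric := by
  rintro J γ hJ hJc ⟨s₀, hs₀⟩ hγ hc
  obtain ⟨k, c, ht⟩ := S.exists_time_eq_affine hr hJ hJc hγ
  have h := ((S.isGeodesicOn_eisenhartMetric_iff hr hJ ht).1 hγ).1
  rcases eq_or_ne k 0 with rfl | hk
  · have hT : c ∈ S.T := by simpa using h.mem s₀ hs₀
    have hv : ∀ s ∈ J, velocity (𝓡 d) (fun s => (γ s).2.1) s = 0 := by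
      intro s hs
      by_contra hne
      have h1 := (hc s hs).2
      rw [S.eisenhartMetric_velocity hJ hγ.1 ht hs] at h1
      have h2 := S.a_pos _ (h.mem s hs) _ _ hne
      norm_num at h1 h2
      linarith
    exact S.exists_geodesic_extension hr hJ hJc hs₀ hγ ht
      (S.isReducedSolutionOn_const hT (γ s₀).2.1 univ)
      fun s hs => eqOn_const_of_velocity_eq_zero hJ hJc h.contMDiffOn hv hs₀ hs
  · obtain ⟨q', hq', he⟩ := hS.exists_extension hr hJ hJc hs₀ hk h
    exact S.exists_geodesic_extension hr hJ hJc hs₀ hγ ht hq' he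

theorem ELFlowComplete.geodesicallyComplete {S : MechanicalSystem d Q r} (hr : 1 ≤ r)
    (hS : S.ELFlowComplete) (hQ : ∀ t ∈ S.T, GeodesicallyComplete (S.a t)) :
    GeodesicallyComplete S.eisenhartMetric := by
  rintro J γ hJ hJc ⟨s₀, hs₀⟩ hγ
  obtain ⟨k, c, ht⟩ := S.exists_time_eq_affine hr hJ hJc hγ
  have h := ((S.isGeodesicOn_eisenhartMetric_iff hr hJ ht).1 hγ).1
  rcases eq_or_ne k 0 with rfl | hk
  · have hT : c ∈ S.T := by simpa using h.mem s₀ hs₀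
    obtain ⟨q', hq', he⟩ := hQ c hT J _ hJ hJc ⟨s₀, hs₀⟩ ((S.isGeodesicOn_metric_iff hr hT).2 h)
    exact S.exists_geodesic_extension hr hJ hJc hs₀ hγ ht
      ((S.isGeodesicOn_metric_iff hr hT).1 hq') he
  · obtain ⟨q', hq', he⟩ := hS.exists_extension hr hJ hJc hs₀ hk h
    exact S.exists_geodesic_extension hr hJ hJc hs₀ hγ ht hq' he

/-- The projection to `Q` of an extension of a geodesic solves the same reduced equation. -/
theorem isReducedSolutionOn_univ_of_extension (hr : 1 ≤ r) {J : Set ℝ} (hJ : IsOpen J) {s₀ : ℝ}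
    (hs₀ : s₀ ∈ J) {k c : ℝ} {γ γ' : ℝ → S.Spacetime}
    (ht : ∀ s ∈ J, ((γ s).1 : ℝ) = k * s + c) (hγ' : IsGeodesicOn S.eisenhartMetric γ' univ)
    (he : EqOn γ' γ J) : S.IsReducedSolutionOn k c (fun s => (γ' s).2.1) univ := by
  obtain ⟨k', c', ht'⟩ := S.exists_time_eq_affine hr isOpen_univ ordConnected_univ hγ'
  -- The times of `γ'` and `γ` are affine and agree on a nonempty open set, hence have the same
  -- coefficients.
  obtain ⟨rfl, rfl⟩ := affine_coeff_eq hJ hs₀ fun s hs =>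
    (ht' s (mem_univ s)).symm.trans ((congrArg (fun x => (x.1 : ℝ)) (he hs)).trans (ht s hs))
  exact ((S.isGeodesicOn_eisenhartMetric_iff hr isOpen_univ ht').1 hγ').1

/-- An Euler-Lagrange solution lifts to a null geodesic with `t = s`. The projection of its
extension solves the equation for all `s`, and its time coordinate forces every real `s` into `T`.
-/
theorem elFlowComplete_of_nullGeodesicallyComplete (hr : 1 ≤ r)
    (hM : NullGeodesicallyComplete S.eisenhartMetric) : S.ELFlowComplete := by
  -- The slope of `y` prescribed in the lift below solves `g(γ', γ') = 0` at `s₀`; constancy of the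
  -- square spreads this over `J`.
  rintro J q hJ hJc ⟨s₀, hs₀⟩ hq
  rw [S.isELSolutionOn_iff hr hJ] at hq
  obtain ⟨γ, hγ, ht, hγq, -, h1⟩ := S.exists_geodesic_lift hr hJ hJc hs₀ hq 0
    (S.a s₀ (q s₀) (velocity (𝓡 d) q s₀) (velocity (𝓡 d) q s₀) / 2 + S.momentum 1 0 q s₀
      + S.V s₀ (q s₀))
  obtain rfl : (fun s => (γ s).2.1) = q := funext hγq
  obtain ⟨n, hn⟩ := S.exists_eisenhartMetric_velocity_eq hr hJ hJc hγ ht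
  have hn0 : n = 0 := by
    rw [← hn s₀ hs₀, S.eisenhartMetric_velocity hJ hγ.1 ht hs₀, h1]
    simp only [one_mul, add_zero]
    ring
  have hnull : IsNullOn S.eisenhartMetric γ J := by
    refine fun s hs => ⟨fun h0 => ?_, (hn s hs).trans hn0⟩
    -- The velocity cannot vanish, since `dt` takes the value `1` on it.
    have e := S.dt_velocity ((hγ.1.contMDiffAt (hJ.mem_nhds hs)).mdifferentiableAt two_ne_zero)
    rw [h0, map_zero, (Filter.eventuallyEq_of_mem (hJ.mem_nhds hs) ht).deriv_eq,
      (hasDerivAt_affine 1 0 s).deriv] at e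
    exact zero_ne_one e
  obtain ⟨γ', hγ', he⟩ := hM J γ hJ hJc ⟨s₀, hs₀⟩ hγ hnull
  exact ⟨fun s => (γ' s).2.1, (S.isELSolutionOn_iff hr isOpen_univ).2
    (S.isReducedSolutionOn_univ_of_extension hr hJ hs₀ ht hγ' he),
    fun s hs => congrArg (fun x => x.2.1) (he hs)⟩

/-- A geodesic of `a t` lifts with `k = 0` into the slice at time `t`; the initial data of `y` play
no role. -/
theorem geodesicallyComplete_metric (hr : 1 ≤ r)
    (hM : GeodesicallyComplete S.eisenhartMetric) {t : ℝ} (hT : t ∈ S.T) :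
    GeodesicallyComplete (S.a t) := by
  rintro J q hJ hJc ⟨s₀, hs₀⟩ hq
  rw [S.isGeodesicOn_metric_iff hr hT] at hq
  obtain ⟨γ, hγ, ht, hγq, -⟩ := S.exists_geodesic_lift hr hJ hJc hs₀ hq 0 0
  obtain ⟨γ', hγ', he⟩ := hM J γ hJ hJc ⟨s₀, hs₀⟩ hγ
  exact ⟨fun s => (γ' s).2.1, (S.isGeodesicOn_metric_iff hr hT).2
    (S.isReducedSolutionOn_univ_of_extension hr hJ hs₀ ht hγ' he),
    fun s hs => (congrArg (fun x => x.2.1) (he hs)).trans (hγq s)⟩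

end Completeness

end MechanicalSystem

end

theorem theorem5p3 {d : ℕ} {Q : Type*} [TopologicalSpace Q]
    [ChartedSpace (EuclideanSpace ℝ (Fin d)) Q] [T2Space Q] [ParacompactSpace Q]
    [ConnectedSpace Q] {r : WithTop ℕ∞} (hr : 2 ≤ r) [IsManifold (𝓡 d) (r + 1) Q]
    (S : MechanicalSystem d Q r) :
    (S.ELFlowComplete ↔ NullGeodesicallyComplete S.eisenhartMetric) ∧
    (S.ELFlowComplete → CausallyGeodesicallyComplete S.eisenhartMetric) ∧
    ((S.ELFlowComplete ∧ ∀ t ∈ S.T, GeodesicallyComplete (S.a t)) ↔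
      GeodesicallyComplete S.eisenhartMetric) := by
  have : IsManifold (𝓡 d) 2 Q := IsManifold.of_le (n := r + 1) (hr.trans le_self_add)
  have hr1 : 1 ≤ r := one_le_two.trans hr
  have hnull : NullGeodesicallyComplete S.eisenhartMetric → S.ELFlowComplete :=
    S.elFlowComplete_of_nullGeodesicallyComplete hr1
  refine ⟨⟨fun h J γ hJ hJc hne hγ hn => ?_, hnull⟩, fun h => h.causallyGeodesicallyComplete hr1,
    fun h => h.1.geodesicallyComplete hr1 h.2, fun h => ⟨hnull fun J γ hJ hJc hne hγ _ =>
      h J γ hJ hJc hne hγ, fun t ht => S.geodesicallyComplete_metric hr1 h ht⟩⟩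
  exact h.causallyGeodesicallyComplete hr1 J γ hJ hJc hne hγ
    fun s hs => ⟨(hn s hs).1, (hn s hs).2.le⟩
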